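/- Let $n\ge 1$, let $0<\zeta_1<\cdots<\zeta_n$ and $b_1(0),\dots,b_n(0)>0$ be real numbers, and for $t\in\mathbb R$ put $$b_j(t)=b_j(0)e^{\zeta_j t},\qquad f_i(t)=\sum_{j=1}^n \zeta_j^{\,i}\,b_j(t)\quad(i=0,1,2,\dots).$$ Recall that the Pfaffian of order $N$ of $2N$ labels $a_1,\dots,a_{2N}$ with antisymmetric entries $(a_i,a_j)$ is $$(a_1,\dots,a_{2N})=\sum_{\sigma}\operatorname{sgn}(\sigma)\prod_{l=1}^{N}(a_{\sigma(2l-1)},a_{\sigma(2l)}),$$ summed over the permutations $\sigma$ of $\{1,\dots,2N\}$ with $\sigma(2l-1)<\sigma(2l)$ for $1\le l\le N$ and $\sigma(2l-1)<\sigma(2l+1)$ for $1\le l<N$; the Pfaffian of order $0$ is $1$. On the labels $d_0,0,1,2,\dots$ take the antisymmetric entries $$(d_0,i)=f_i(t),\qquad (i,j)=\iint_{-\infty<t_1<t_2<t}\bigl[f_{i+1}(t_1)f_{j+1}(t_2)-f_{i+1}(t_2)f_{j+1}(t_1)\bigr]\,dt_1\,dt_2 ,$$ and define $$\tau_{2k}=(0,1,\dots,2k-1)\quad(k\ge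 0),\qquad \tau_{2k-1}=(d_0,0,1,\dots,2k-2)\quad(k\ge1),$$ with $\tau_0=1$ and $\tau_k=0$ for $k<0$. Then the integrals $(i,j)$ converge absolutely, $\tau_k(t)>0$ for $1\le k\le n$ and all $t\in\mathbb R$, $\log\tau_k$ is differentiable on $\mathbb R$ for $0\le k\le n$, and $$p_k=\frac{\tau_{k+1}\tau_{k-1}}{\tau_k^2},\qquad q_k=\frac{d}{dt}\log\tau_k\qquad(0\le k\le n)$$ is, for all $t\in\mathbb R$, a solution of the finite nonlinear B-Toda lattice $$\dot p_k=p_k(q_{k+1}-2q_k+q_{k-1}),\qquad \dot q_k=(q_{k+1}-q_{k-1})\,p_k,\qquad k=1,\dots,n,$$ with the boundary conditions $p_0=p_n=q_0=p_nq_{n+1}=0$. (Since $\tau_{n+1}=0$, the quantity $q_{n+1}$ is not given by the formula; it enters only through the product $p_nq_{n+1}$, and the assertion holds for an arbitrary function $q_{n+1}:\mathbb R\to\mathbb R$.) -/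

import Mathlib

open MeasureTheory

namespace BToda

/-- The permutation `σ = (i₁, i₂, …, i_{2N})` lists the points of `Fin (2 * N)` as pairs
`(i₁, i₂), (i₃, i₄), …` with increasing first members and each pair increasing.
(Positions are counted from `0`, so the `l`-th pair sits at positions `2 * l`, `2 * l + 1`.) -/
def IsPairing {N : ℕ} (σ : Equiv.Perm (Fin (2 * N))) : Prop :=
  (∀ l m : Fin N, l < m → σ ⟨2 * l, by omega⟩ < σ ⟨2 * m, by omega⟩) ∧
    ∀ l : Fin N, σ ⟨2 * l, by omega⟩ < σ ⟨2 * l + 1, by omega⟩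

instance {N : ℕ} : DecidablePred (IsPairing (N := N)) := fun _ =>
  inferInstanceAs (Decidable (_ ∧ _))

/-- The Pfaffian of order `N` (of a `2N × 2N` array `A`, antisymmetric in all uses):
the signed sum over all pairings of `Fin (2 * N)`. The one of order `0` is `1`. -/
def pfaffian {R : Type*} [CommRing R] (N : ℕ) (A : Fin (2 * N) → Fin (2 * N) → R) : R :=
  ∑ σ : Equiv.Perm (Fin (2 * N)) with IsPairing σ,
    ((Equiv.Perm.sign σ : ℤ) : R) *
      ∏ l : Fin N, A (σ ⟨2 * l, by omega⟩) (σ ⟨2 * l + 1, by omega⟩)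

/-- The labels that occur in the Pfaffians: the character `d₀` and the numbers `0, 1, 2, …`. -/
inductive Label where
  | d0 : Label
  | num (i : ℕ) : Label

noncomputable section

/-- `b_j(t) = b_j(0) e^{ζ_j t}`, with `b_j(0) = β j`. -/
def weight {n : ℕ} (ζ β : Fin n → ℝ) (j : Fin n) (t : ℝ) : ℝ :=
  β j * Real.exp (ζ j * t)

/-- `f_i(t) = ∑_j ζ_j^i b_j(t)`. -/
def moment {n : ℕ} (ζ β : Fin n → ℝ) (i : ℕ) (t : ℝ) : ℝ :=
  ∑ j : Fin n, ζ j ^ i * weight ζ β j t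

/-- The domain `-∞ < t₁ < t₂ < t`. -/
def wedge (t : ℝ) : Set (ℝ × ℝ) := {s | s.1 < s.2 ∧ s.2 < t}

/-- `f_{i+1}(t₁) f_{j+1}(t₂) - f_{i+1}(t₂) f_{j+1}(t₁)`. -/
def entryIntegrand {n : ℕ} (ζ β : Fin n → ℝ) (i j : ℕ) (s : ℝ × ℝ) : ℝ :=
  moment ζ β (i + 1) s.1 * moment ζ β (j + 1) s.2 -
    moment ζ β (i + 1) s.2 * moment ζ β (j + 1) s.1

/-- The Pfaffian entries: `(d₀, i) = f_i(t) = -(i, d₀)` and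
`(i, j) = ∬_{-∞ < t₁ < t₂ < t} [f_{i+1}(t₁) f_{j+1}(t₂) - f_{i+1}(t₂) f_{j+1}(t₁)] dt₁ dt₂`. -/
def entry {n : ℕ} (ζ β : Fin n → ℝ) (t : ℝ) : Label → Label → ℝ
  | .d0, .d0 => 0
  | .d0, .num i => moment ζ β i t
  | .num i, .d0 => -moment ζ β i t
  | .num i, .num j => ∫ s in wedge t, entryIntegrand ζ β i j s

/-- The word `(d₀, 0, 1, 2, …)`. -/
def oddWord : ℕ → Label
  | 0 => .d0
  | m + 1 => .num m

/-- The τ-functions: `τ_{2k} = (0, …, 2k-1)` and `τ_{2k-1} = (d₀, 0, …, 2k-2)`, both of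
order `k`, with `τ_0 = 1` and `τ_k = 0` for `k < 0`. -/
def tau {n : ℕ} (ζ β : Fin n → ℝ) : ℤ → ℝ → ℝ
  | .negSucc _, _ => 0
  | .ofNat m, t =>
    if Even m then
      pfaffian (m / 2) fun a b => entry ζ β t (.num a) (.num b)
    else
      pfaffian ((m + 1) / 2) fun a b => entry ζ β t (oddWord a) (oddWord b)

end

/-- `(p, q)` solves, at all times, the finite nonlinear B-Toda lattice
`ṗ_k = p_k (q_{k+1} - 2 q_k + q_{k-1})`, `q̇_k = (q_{k+1} - q_{k-1}) p_k` for `k = 1, …, n`,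
with the boundary `p_0 = p_n = q_0 = p_n q_{n+1} = 0`. -/
structure IsSolution (n : ℕ) (p q : ℤ → ℝ → ℝ) : Prop where
  p_zero : ∀ t, p 0 t = 0
  p_last : ∀ t, p n t = 0
  q_zero : ∀ t, q 0 t = 0
  pq_last : ∀ t, p n t * q (n + 1) t = 0
  deriv_p : ∀ k : ℤ, 1 ≤ k → k ≤ n → ∀ t,
    HasDerivAt (p k) (p k t * (q (k + 1) t - 2 * q k t + q (k - 1) t)) t
  deriv_q : ∀ k : ℤ, 1 ≤ k → k ≤ n → ∀ t,
    HasDerivAt (q k) ((q (k + 1) t - q (k - 1) t) * p k t) t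

end BToda

/-!
Write `S(x, y) = (y - x) / (y + x)`. Carrying out the integrals gives
`(i, j) = ∑_{a, b} ζ_a^i b_a S(ζ_a, ζ_b) ζ_b^j b_b`, and the label `d₀` behaves like one more node
`0`, because `S(0, y) = 1` for `y ≠ 0` (`entry_num_num`, `entry_oddWord`). So every τ-function is
the Pfaffian of a matrix `Vᵀ S V`. Minor summation (`pfaffian_transpose_schurKernel_mul`), Schur's
Pfaffian `Pf S(z_i, z_j) = ∏_{i < j} S(z_i, z_j)` (`pfaffian_schurKernel`) and the Vandermonde
determinant turn it, for even and for odd `m` alike, into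

  `m! τ_m = ∑_g ∏_x b_{g x} ∏_{x < y} (ζ_{g y} - ζ_{g x})² / (ζ_{g y} + ζ_{g x})`,

summed over all maps `g` from `Fin m` to the nodes (`factorial_mul_tau`). Only injective `g`
contribute, and they contribute positive exponentials: hence `τ_m > 0` for `m ≤ n`,
`τ_{n + 1} = 0`, and all derivatives are known. Sums over maps are used instead of sums over sets of
nodes because they turn the symmetrisations below into plain exchanges of summation.

The equation for `ṗ_k` is the logarithmic derivative of the definition of `p_k`. The equation for
`q̇_k` is the bilinear equation `τ_k'' τ_k - τ_k'² = τ_{k+1}' τ_{k-1} - τ_{k+1} τ_{k-1}'`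
(`tauMoment_bilinear`). With the closed form inserted, both sides are sums over words of length
`2 * k` that are cut into two parts. Averaging over all the ways to cut them reduces the equation to
an identity of symmetric polynomials in `2 * k` variables (`colouringSum_eq_zero`), which is
proved by induction on `k`: where two variables agree, the polynomial reduces to the one for
`k - 1`, so by symmetry it has a double zero there. For `k ≥ 3` its degree in one variable, at most
`3 * k`, is too small to allow a double zero at each of the `2 * k - 1` others; the cases `k ≤ 2`
are checked by expansion.

Working with the Pfaffian as a sum over all permutations (`exists_sum_pfaffianTerm_eq`) makes its
antisymmetry and minor summation immediate; the sum over pairings gives the expansion along the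
first row (`pfaffian_succ`) that carries the induction for Schur's Pfaffian.
-/

namespace BToda

/-! ### The Pfaffian as a sum over all permutations -/

section

/-- The points of `Fin (2 * N)` as `N` pairs: `(l, false)` and `(l, true)` are the positions
`2 * l` and `2 * l + 1`. -/
def pairEquiv (N : ℕ) : Fin N × Bool ≃ Fin (2 * N) where
  toFun p := ⟨2 * p.1 + (if p.2 then 1 else 0), by have := p.1.2; split_ifs <;> omega⟩
  invFun x := (⟨x / 2, by omega⟩, decide ((x : ℕ) % 2 = 1))
  left_inv := by
    rintro ⟨⟨l, hl⟩, b⟩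
    cases b
    · simp
    · simp
      omega
  right_inv := by
    rintro ⟨x, hx⟩
    rcases Nat.mod_two_eq_zero_or_one x with h | h <;> simp [h] <;> omega

/-- The permutation of `Fin (2 * N)` that moves the `l`-th pair to the place of the `π l`-th one
and swaps the two points of that place if `s (π l)` holds. -/
def pairPerm {N : ℕ} (π : Equiv.Perm (Fin N)) (s : Fin N → Bool) : Equiv.Perm (Fin (2 * N)) :=
  (pairEquiv N).permCongr
    (Equiv.prodCongrRight (fun l => if s l then Equiv.boolNot else 1) *
      Equiv.prodCongrLeft (fun _ => π))

lemma pairPerm_pairEquiv {N : ℕ} (π : Equiv.Perm (Fin N)) (s : Fin N → Bool) (l : Fin N)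
    (b : Bool) : pairPerm π s (pairEquiv N (l, b)) = pairEquiv N (π l, xor b (s (π l))) := by
  by_cases h : s (π l) <;> simp [pairPerm, h]

lemma sign_pairPerm {N : ℕ} (π : Equiv.Perm (Fin N)) (s : Fin N → Bool) :
    Equiv.Perm.sign (pairPerm π s) = ∏ l, if s l then -1 else 1 := by
  have hs : Equiv.Perm.sign Equiv.boolNot = -1 := by decide
  rw [pairPerm, Equiv.Perm.sign_permCongr, Equiv.Perm.sign_mul, Equiv.Perm.sign_prodCongrLeft,
    Equiv.Perm.sign_prodCongrRight]
  simp only [Fintype.prod_bool, Int.units_mul_self, mul_one]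
  refine Finset.prod_congr rfl fun l _ => ?_
  by_cases h : s l <;> simp [h, hs]

variable {R : Type*} [CommRing R]

/-- The term of a permutation in the Pfaffian of `A`. -/
def pfaffianTerm {N : ℕ} (A : Fin (2 * N) → Fin (2 * N) → R) (σ : Equiv.Perm (Fin (2 * N))) : R :=
  ((Equiv.Perm.sign σ : ℤ) : R) *
    ∏ l : Fin N, A (σ (pairEquiv N (l, false))) (σ (pairEquiv N (l, true)))

lemma pfaffian_eq_sum_pfaffianTerm {N : ℕ} (A : Fin (2 * N) → Fin (2 * N) → R) :
    pfaffian N A = ∑ σ : Equiv.Perm (Fin (2 * N)) with IsPairing σ, pfaffianTerm A σ := rfl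

/-- Reordering the pairs and swapping inside the pairs does not change the term. -/
lemma pfaffianTerm_mul_pairPerm {N : ℕ} {A : Fin (2 * N) → Fin (2 * N) → R}
    (hA : ∀ i j, A i j = -A j i) (σ : Equiv.Perm (Fin (2 * N))) (π : Equiv.Perm (Fin N))
    (s : Fin N → Bool) : pfaffianTerm A (σ * pairPerm π s) = pfaffianTerm A σ := by
  have h1 : ∏ l : Fin N, A ((σ * pairPerm π s) (pairEquiv N (l, false)))
        ((σ * pairPerm π s) (pairEquiv N (l, true))) =
      ∏ l : Fin N, ((if s l then -1 else 1) *
        A (σ (pairEquiv N (l, false))) (σ (pairEquiv N (l, true)))) := by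
    rw [← Equiv.prod_comp π (fun l => ((if s l then -1 else 1) *
        A (σ (pairEquiv N (l, false))) (σ (pairEquiv N (l, true)))))]
    refine Finset.prod_congr rfl fun l _ => ?_
    simp only [Equiv.Perm.mul_apply, pairPerm_pairEquiv]
    by_cases h : s (π l)
    · simp only [h, Bool.xor_true, Bool.not_false, Bool.not_true, if_true]
      rw [hA, neg_one_mul]
    · simp [h]
  have h2 : (((Equiv.Perm.sign (pairPerm π s) : ℤˣ) : ℤ) : R) =
      ∏ l, (if s l then -1 else 1) := by
    rw [sign_pairPerm]
    push_cast
    refine Finset.prod_congr rfl fun l _ => ?_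
    split_ifs <;> simp
  have h3 : (∏ l, (if s l then -1 else 1 : R)) * ∏ l, (if s l then -1 else 1 : R) = 1 := by
    rw [← Finset.prod_mul_distrib]
    refine Finset.prod_eq_one fun l _ => ?_
    split_ifs <;> simp
  rw [pfaffianTerm, h1, Finset.prod_mul_distrib, Equiv.Perm.sign_mul, Units.val_mul, Int.cast_mul,
    h2, pfaffianTerm]
  linear_combination (((Equiv.Perm.sign σ : ℤˣ) : ℤ) : R) *
    (∏ l : Fin N, A (σ (pairEquiv N (l, false))) (σ (pairEquiv N (l, true)))) * h3

/-- Every permutation is turned into a pairing by exactly one rearrangement of its pairs. -/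
lemma existsUnique_isPairing_mul_pairPerm {N : ℕ} (σ : Equiv.Perm (Fin (2 * N))) :
    ∃! p : Equiv.Perm (Fin N) × (Fin N → Bool), IsPairing (σ * pairPerm p.1 p.2) := by
  set u : Fin N → Fin (2 * N) := fun l => σ (pairEquiv N (l, false)) with hu
  set v : Fin N → Fin (2 * N) := fun l => σ (pairEquiv N (l, true)) with hv
  have huv : ∀ l m, u l ≠ v m := by
    intro l m h
    simpa using (pairEquiv N).injective (σ.injective h)
  set s₀ : Fin N → Bool := fun l => decide (v l < u l) with hs₀
  set f : Fin N → Fin (2 * N) := fun l => σ (pairEquiv N (l, s₀ l)) with hf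
  have hfinj : Function.Injective f := by
    intro l m h
    simpa using congrArg Prod.fst ((pairEquiv N).injective (σ.injective h))
  -- the pair at `l` is increasing after the swap exactly when the swap is the prescribed one
  have key : ∀ (l : Fin N) (b : Bool),
      σ (pairEquiv N (l, xor false b)) < σ (pairEquiv N (l, xor true b)) ↔ b = s₀ l := by
    intro l b
    have h := huv l l
    cases b
    · simp only [hs₀, Bool.xor_false]
      change u l < v l ↔ _
      rw [eq_comm, decide_eq_false_iff_not, not_lt]
      exact ⟨le_of_lt, fun h' => lt_of_le_of_ne h' h⟩
    · simp only [hs₀, Bool.xor_true, Bool.not_false, Bool.not_true]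
      change v l < u l ↔ _
      rw [eq_comm, decide_eq_true_iff]
  have main : ∀ (π : Equiv.Perm (Fin N)) (s : Fin N → Bool),
      IsPairing (σ * pairPerm π s) ↔ s = s₀ ∧ StrictMono (f ∘ π) := by
    intro π s
    have e1 : IsPairing (σ * pairPerm π s) ↔
        (∀ l m : Fin N, l < m → σ (pairPerm π s (pairEquiv N (l, false))) <
          σ (pairPerm π s (pairEquiv N (m, false)))) ∧
        ∀ l : Fin N, σ (pairPerm π s (pairEquiv N (l, false))) <
          σ (pairPerm π s (pairEquiv N (l, true))) := Iff.rfl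
    rw [e1]
    simp only [pairPerm_pairEquiv, key]
    constructor
    · rintro ⟨h1, h2⟩
      have hs : s = s₀ := by
        funext l
        simpa using h2 (π.symm l)
      subst hs
      refine ⟨rfl, fun l m hlm => ?_⟩
      simpa [hf] using h1 l m hlm
    · rintro ⟨rfl, h⟩
      refine ⟨fun l m hlm => ?_, fun l => rfl⟩
      simpa [hf] using h hlm
  refine ⟨(Tuple.sort f, s₀), ?_, ?_⟩
  · refine (main _ _).2 ⟨rfl, ?_⟩
    exact (Tuple.monotone_sort f).strictMono_of_injective
      (hfinj.comp (Tuple.sort f).injective)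
  · rintro ⟨π, s⟩ h
    obtain ⟨rfl, hπ⟩ := (main π s).1 h
    have hπ' : f ∘ π = f ∘ Tuple.sort f := Tuple.comp_sort_eq_comp_iff_monotone.2 hπ.monotone
    have : π = Tuple.sort f := Equiv.ext fun l => hfinj (congrFun hπ' l)
    rw [this]

/-- The sum over all permutations is a multiple of the Pfaffian: the pairings represent the
cosets of the group of rearrangements of the pairs, and the terms are constant on the cosets. -/
theorem exists_sum_pfaffianTerm_eq (N : ℕ) : ∃ c : ℕ, c ≠ 0 ∧
    ∀ A : Fin (2 * N) → Fin (2 * N) → ℝ, (∀ i j, A i j = -A j i) →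
      ∑ σ, pfaffianTerm A σ = c * pfaffian N A := by
  refine ⟨Fintype.card (Equiv.Perm (Fin N) × (Fin N → Bool)), Fintype.card_ne_zero, ?_⟩
  intro A hA
  calc ∑ σ, pfaffianTerm A σ
      = ∑ σ, ∑ p : Equiv.Perm (Fin N) × (Fin N → Bool),
          if IsPairing (σ * pairPerm p.1 p.2) then pfaffianTerm A σ else 0 := by
        refine Finset.sum_congr rfl fun σ _ => ?_
        obtain ⟨p, hp, hp'⟩ := existsUnique_isPairing_mul_pairPerm σ
        rw [Finset.sum_eq_single p]
        · rw [if_pos hp]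
        · intro q _ hq
          exact if_neg fun h => hq (hp' q h)
        · simp
    _ = ∑ p : Equiv.Perm (Fin N) × (Fin N → Bool), ∑ σ,
          if IsPairing (σ * pairPerm p.1 p.2) then
            pfaffianTerm A (σ * pairPerm p.1 p.2) else 0 := by
        rw [Finset.sum_comm]
        simp only [pfaffianTerm_mul_pairPerm hA]
    _ = ∑ p : Equiv.Perm (Fin N) × (Fin N → Bool), pfaffian N A := by
        refine Finset.sum_congr rfl fun p _ => ?_
        rw [pfaffian_eq_sum_pfaffianTerm, Finset.sum_filter]
        exact Equiv.sum_comp (Equiv.mulRight (pairPerm p.1 p.2))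
          fun σ => if IsPairing σ then pfaffianTerm A σ else 0
    _ = _ := by
        rw [Finset.sum_const, Finset.card_univ, nsmul_eq_mul]

lemma sum_pfaffianTerm_comp {N : ℕ} (A : Fin (2 * N) → Fin (2 * N) → R)
    (τ : Equiv.Perm (Fin (2 * N))) :
    ∑ σ, pfaffianTerm (fun i j => A (τ i) (τ j)) σ =
      ((Equiv.Perm.sign τ : ℤ) : R) * ∑ σ, pfaffianTerm A σ := by
  rw [Finset.mul_sum, ← Equiv.sum_comp (Equiv.mulLeft τ) (fun σ =>
    ((Equiv.Perm.sign τ : ℤ) : R) * pfaffianTerm A σ)]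
  refine Finset.sum_congr rfl fun σ _ => ?_
  have h : ((Equiv.Perm.sign τ : ℤ) : R) * ((Equiv.Perm.sign τ : ℤ) : R) = 1 := by
    rw [← Int.cast_mul, ← Units.val_mul, Int.units_mul_self]; simp
  simp only [pfaffianTerm, Equiv.coe_mulLeft, Equiv.Perm.mul_apply, Equiv.Perm.sign_mul,
    Units.val_mul, Int.cast_mul]
  linear_combination (-((Equiv.Perm.sign σ : ℤ) : R) *
    ∏ l : Fin N, A (τ (σ (pairEquiv N (l, false)))) (τ (σ (pairEquiv N (l, true))))) * h

/-- A Pfaffian with two equal rows vanishes. -/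
lemma pfaffian_eq_zero_of_swap {N : ℕ} {A : Fin (2 * N) → Fin (2 * N) → ℝ}
    (hA : ∀ i j, A i j = -A j i) {x y : Fin (2 * N)} (hxy : x ≠ y)
    (h : ∀ i j, A (Equiv.swap x y i) (Equiv.swap x y j) = A i j) : pfaffian N A = 0 := by
  obtain ⟨c, hc, hF⟩ := exists_sum_pfaffianTerm_eq N
  have h1 := sum_pfaffianTerm_comp A (Equiv.swap x y)
  simp only [h, hF A hA, Equiv.Perm.sign_swap hxy] at h1
  have hc' : (c : ℝ) ≠ 0 := by exact_mod_cast hc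
  have : (c : ℝ) * pfaffian N A = 0 := by
    push_cast at h1
    linarith
  exact (mul_eq_zero.1 this).resolve_left hc'

end

/-! ### Expansion of a Pfaffian along its first row -/

section

/-- The permutation of `2 * N + 2` points that pairs the first point with the `j`-th of the others
and acts on the remaining ones like `ρ`. -/
def insertPair {N : ℕ} (j : Fin (2 * N + 1)) (ρ : Equiv.Perm (Fin (2 * N))) :
    Equiv.Perm (Fin (2 * N + 2)) :=
  Equiv.Perm.decomposeFin.symm (0, (Fin.cycleRange j).symm * Equiv.Perm.decomposeFin.symm (0, ρ))

lemma insertPair_zero {N : ℕ} (j : Fin (2 * N + 1)) (ρ : Equiv.Perm (Fin (2 * N))) :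
    insertPair j ρ 0 = 0 := by
  simp [insertPair]

lemma insertPair_one {N : ℕ} (j : Fin (2 * N + 1)) (ρ : Equiv.Perm (Fin (2 * N))) :
    insertPair j ρ (Fin.succ 0) = j.succ := by
  rw [insertPair, Equiv.Perm.decomposeFin_symm_apply_succ]
  simp

lemma insertPair_succ_succ {N : ℕ} (j : Fin (2 * N + 1)) (ρ : Equiv.Perm (Fin (2 * N)))
    (x : Fin (2 * N)) : insertPair j ρ x.succ.succ = (j.succAbove (ρ x)).succ := by
  simp [insertPair]

lemma sign_insertPair {N : ℕ} (j : Fin (2 * N + 1)) (ρ : Equiv.Perm (Fin (2 * N))) :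
    Equiv.Perm.sign (insertPair j ρ) = (-1) ^ (j : ℕ) * Equiv.Perm.sign ρ := by
  simp [insertPair]

lemma insertPair_injective {N : ℕ} : Function.Injective
    fun p : Fin (2 * N + 1) × Equiv.Perm (Fin (2 * N)) => insertPair p.1 p.2 := by
  rintro ⟨j, ρ⟩ ⟨j', ρ'⟩ h
  have hj : j = j' := by
    have h1 := congrArg (fun σ : Equiv.Perm (Fin (2 * N + 2)) => σ (Fin.succ 0)) h
    simp only [insertPair_one] at h1
    exact Fin.succ_injective _ h1
  subst hj
  simpa [insertPair] using h

lemma exists_insertPair_eq {N : ℕ} {σ : Equiv.Perm (Fin (2 * N + 2))} (hσ : σ 0 = 0) :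
    ∃ j ρ, insertPair j ρ = σ := by
  have peel : ∀ {n : ℕ} (τ : Equiv.Perm (Fin (n + 1))), τ 0 = 0 →
      ∃ τ', Equiv.Perm.decomposeFin.symm (0, τ') = τ := by
    intro n τ hτ
    refine ⟨(Equiv.Perm.decomposeFin τ).2, ?_⟩
    have h := Equiv.Perm.decomposeFin_symm_apply_zero (Equiv.Perm.decomposeFin τ).1
      (Equiv.Perm.decomposeFin τ).2
    rw [Prod.mk.eta, Equiv.symm_apply_apply, hτ] at h
    rw [h, Prod.mk.eta, Equiv.symm_apply_apply]
  obtain ⟨σ', rfl⟩ := peel σ hσ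
  obtain ⟨ρ, hρ⟩ := peel (Fin.cycleRange (σ' 0) * σ') (by simp)
  refine ⟨σ' 0, ρ, ?_⟩
  rw [insertPair, hρ, ← mul_assoc]
  congr 2
  ext x
  simp

lemma IsPairing.apply_zero {N : ℕ} {σ : Equiv.Perm (Fin (2 * N + 2))}
    (h : IsPairing (N := N + 1) σ) : σ 0 = 0 := by
  obtain ⟨⟨l, b⟩, hx⟩ := (pairEquiv (N + 1)).surjective (σ.symm 0)
  have h1 : ∀ l : Fin (N + 1), σ 0 ≤ σ (pairEquiv (N + 1) (l, false)) := by
    intro l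
    rcases Fin.eq_zero_or_eq_succ l with rfl | ⟨m, rfl⟩
    · exact le_of_eq rfl
    · exact (h.1 0 m.succ (Fin.succ_pos m)).le
  have h2 : σ 0 ≤ σ (pairEquiv (N + 1) (l, b)) := by
    cases b
    · exact h1 l
    · exact (h1 l).trans (h.2 l).le
  rw [hx, Equiv.apply_symm_apply] at h2
  exact le_antisymm h2 (Fin.zero_le _)

lemma isPairing_iff {N : ℕ} (σ : Equiv.Perm (Fin (2 * N))) : IsPairing σ ↔
    (∀ l m : Fin N, l < m → σ (pairEquiv N (l, false)) < σ (pairEquiv N (m, false))) ∧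
      ∀ l : Fin N, σ (pairEquiv N (l, false)) < σ (pairEquiv N (l, true)) := Iff.rfl

lemma pairEquiv_succ (N : ℕ) (l : Fin N) (b : Bool) :
    (pairEquiv (N + 1) (l.succ, b) : Fin (2 * N + 2)) = (pairEquiv N (l, b)).succ.succ := by
  apply Fin.ext
  change 2 * (l.succ : ℕ) + _ = 2 * (l : ℕ) + _ + 1 + 1
  rw [Fin.val_succ]
  ring

lemma insertPair_pairEquiv_zero {N : ℕ} (j : Fin (2 * N + 1)) (ρ : Equiv.Perm (Fin (2 * N)))
    (b : Bool) : insertPair j ρ (pairEquiv (N + 1) (0, b)) = if b then j.succ else 0 := by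
  cases b
  · exact insertPair_zero j ρ
  · exact insertPair_one j ρ

lemma insertPair_pairEquiv_succ {N : ℕ} (j : Fin (2 * N + 1)) (ρ : Equiv.Perm (Fin (2 * N)))
    (l : Fin N) (b : Bool) : insertPair j ρ (pairEquiv (N + 1) (l.succ, b)) =
      (j.succAbove (ρ (pairEquiv N (l, b)))).succ := by
  rw [← insertPair_succ_succ, ← pairEquiv_succ]

lemma isPairing_insertPair {N : ℕ} (j : Fin (2 * N + 1)) (ρ : Equiv.Perm (Fin (2 * N))) :
    IsPairing (N := N + 1) (insertPair j ρ) ↔ IsPairing ρ := by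
  have e : IsPairing (N := N + 1) (insertPair j ρ) ↔
    (∀ l m : Fin (N + 1), l < m → insertPair j ρ (pairEquiv (N + 1) (l, false)) <
        insertPair j ρ (pairEquiv (N + 1) (m, false))) ∧
      ∀ l : Fin (N + 1), insertPair j ρ (pairEquiv (N + 1) (l, false)) <
        insertPair j ρ (pairEquiv (N + 1) (l, true)) := Iff.rfl
  rw [e, isPairing_iff]
  simp only [Fin.forall_fin_succ, insertPair_pairEquiv_succ, insertPair_pairEquiv_zero,
    Fin.succ_lt_succ_iff, (Fin.strictMono_succAbove j).lt_iff_lt]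
  simp

theorem pfaffian_succ {R : Type*} [CommRing R] {N : ℕ} (A : Fin (2 * N + 2) → Fin (2 * N + 2) → R) :
    pfaffian (N + 1) A = ∑ j : Fin (2 * N + 1), (-1) ^ (j : ℕ) * A 0 j.succ *
      pfaffian N fun a b => A (j.succAbove a).succ (j.succAbove b).succ := by
  simp only [pfaffian_eq_sum_pfaffianTerm, Finset.mul_sum]
  rw [← Finset.sum_product']
  symm
  refine Finset.sum_nbij (fun p => insertPair p.1 p.2) ?_ insertPair_injective.injOn ?_ ?_
  · rintro ⟨j, ρ⟩ h
    simpa [isPairing_insertPair] using h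
  · intro σ hσ
    have hσ' : IsPairing (N := N + 1) σ := by simpa using hσ
    obtain ⟨j, ρ, rfl⟩ := exists_insertPair_eq hσ'.apply_zero
    refine ⟨(j, ρ), ?_, rfl⟩
    simpa using (isPairing_insertPair j ρ).1 hσ'
  · rintro ⟨j, ρ⟩ -
    have h2 : ((Equiv.Perm.sign (insertPair j ρ) : ℤ) : R) =
        (-1) ^ (j : ℕ) * ((Equiv.Perm.sign ρ : ℤ) : R) := by
      rw [sign_insertPair]; push_cast; rfl
    have h3 : pfaffianTerm (N := N + 1) A (insertPair j ρ) =
        ((Equiv.Perm.sign (insertPair j ρ) : ℤ) : R) * ∏ l : Fin (N + 1),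
          A (insertPair j ρ (pairEquiv (N + 1) (l, false)))
            (insertPair j ρ (pairEquiv (N + 1) (l, true))) := rfl
    rw [h3, h2, Fin.prod_univ_succ]
    simp only [insertPair_pairEquiv_succ, insertPair_pairEquiv_zero, pfaffianTerm]
    simp only [if_true, Bool.false_eq_true, if_false]
    ring

end

/-! ### Schur's Pfaffian -/

section

/-- The entry `(y - x) / (y + x)` of Schur's Pfaffian. -/
noncomputable def schurKernel (x y : ℝ) : ℝ := (y - x) / (y + x)

lemma schurKernel_antisymm (x y : ℝ) : schurKernel x y = -schurKernel y x := by
  rw [schurKernel, schurKernel, ← neg_div, neg_sub, add_comm x y]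

/-- Taking the `j`-th point out of a product of an antisymmetric function over all pairs. -/
lemma prod_pairs_succAbove {R : Type*} [CommRing R] {n : ℕ}
    {f : Fin (n + 1) → Fin (n + 1) → R} (hf : ∀ i j, f i j = -f j i) (j : Fin (n + 1)) :
    ∏ i, ∏ k ∈ Finset.Ioi i, f i k = (-1) ^ (j : ℕ) * (∏ a, f j (j.succAbove a)) *
      ∏ a, ∏ b ∈ Finset.Ioi a, f (j.succAbove a) (j.succAbove b) := by
  have h := Equiv.Perm.prod_Ioi_comp_eq_sign_mul_prod (Fin.cycleRange j).symm hf
  rw [Fin.prod_univ_succ, Fin.prod_Ioi_zero, Equiv.Perm.sign_symm, Fin.sign_cycleRange] at h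
  simp only [Fin.prod_Ioi_succ, Fin.cycleRange_symm_zero, Fin.cycleRange_symm_succ] at h
  rw [mul_assoc, h, ← mul_assoc]
  push_cast
  rw [← mul_pow]
  simp

open Polynomial in
/-- **Schur's Pfaffian**. As a function of the first variable `x`, the Pfaffian times
`∏ (z_j + x)` is a polynomial of degree less than the number of variables; it vanishes where `x`
equals another variable, and at some `x = -z_j` its value is known by induction. -/
theorem pfaffian_schurKernel : ∀ (N : ℕ) (z : Fin (2 * N) → ℝ), Function.Injective z →
    (∀ i j, i ≠ j → z i + z j ≠ 0) →
    pfaffian N (fun i j => schurKernel (z i) (z j)) =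
      ∏ i, ∏ j ∈ Finset.Ioi i, schurKernel (z i) (z j) := by
  intro N
  induction N with
  | zero => intro z _ _; simp [pfaffian, IsPairing]
  | succ N ih =>
    intro z hz hz2
    change Fin (2 * N + 2) → ℝ at z
    change ∀ i j : Fin (2 * N + 2), i ≠ j → z i + z j ≠ 0 at hz2
    set w : Fin (2 * N + 1) → ℝ := fun j => z j.succ with hw
    have hwinj : Function.Injective w := hz.comp (Fin.succ_injective _)
    have hw2 : ∀ i j, i ≠ j → w i + w j ≠ 0 := fun i j hij =>
      hz2 _ _ fun h => hij (Fin.succ_injective _ h)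
    set K : Fin (2 * N + 1) → ℝ := fun j => ∏ a, ∏ b ∈ Finset.Ioi a,
      schurKernel (w (j.succAbove a)) (w (j.succAbove b)) with hK
    set L : ℝ := ∏ a, ∏ b ∈ Finset.Ioi a, schurKernel (w a) (w b) with hL
    have expand : ∀ x : ℝ, pfaffian (N + 1) (fun i j : Fin (2 * N + 2) =>
        schurKernel ((Fin.cons x w : Fin (2 * N + 2) → ℝ) i)
          ((Fin.cons x w : Fin (2 * N + 2) → ℝ) j)) =
        ∑ j : Fin (2 * N + 1), (-1) ^ (j : ℕ) * schurKernel x (w j) * K j := by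
      intro x
      rw [pfaffian_succ]
      refine Finset.sum_congr rfl fun j _ => ?_
      simp only [Fin.cons_zero, Fin.cons_succ]
      rw [ih (fun a => w (j.succAbove a)) (hwinj.comp Fin.succAbove_right_injective)
        fun a b hab => hw2 _ _ fun h => hab (Fin.succAbove_right_injective h)]
    have hLK : ∀ j : Fin (2 * N + 1),
        L = (-1) ^ (j : ℕ) * (∏ a, schurKernel (w j) (w (j.succAbove a))) * K j := fun j =>
      prod_pairs_succAbove (f := fun a b => schurKernel (w a) (w b))
        (fun a b => schurKernel_antisymm _ _) j
    -- both sides, multiplied by the product of the denominators in `x`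
    set p : ℝ[X] := ∑ j : Fin (2 * N + 1),
      C ((-1) ^ (j : ℕ) * K j) * ((C (w j) - X) * ∏ a, (C (w (j.succAbove a)) + X)) with hp
    set q : ℝ[X] := C L * ∏ j, (C (w j) - X) with hq
    have hpe : ∀ x, p.eval x = ∑ j : Fin (2 * N + 1),
        ((-1) ^ (j : ℕ) * K j) * ((w j - x) * ∏ a, (w (j.succAbove a) + x)) := by
      intro x
      simp [hp, eval_finsetSum, eval_prod]
    have hqe : ∀ x, q.eval x = L * ∏ j, (w j - x) := by
      intro x
      simp [hq, eval_prod]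
    have hpx : ∀ x, (∀ j, w j + x ≠ 0) → p.eval x = (∏ j, (w j + x)) *
        ∑ j : Fin (2 * N + 1), (-1) ^ (j : ℕ) * schurKernel x (w j) * K j := by
      intro x hx
      rw [hpe, Finset.mul_sum]
      refine Finset.sum_congr rfl fun j _ => ?_
      rw [Fin.prod_univ_succAbove _ j, schurKernel]
      have := hx j
      field_simp
    have hdeg : max p.natDegree q.natDegree ≤ 2 * N + 1 := by
      have h1 : ∀ c : ℝ, (C c - X).natDegree ≤ 1 := fun c =>
        (natDegree_sub_le _ _).trans (by simp)
      have h2 : ∀ c : ℝ, (C c + X).natDegree ≤ 1 := fun c =>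
        (natDegree_add_le _ _).trans (by simp)
      apply max_le
      · refine natDegree_sum_le_of_forall_le _ _ fun j _ => ?_
        refine (natDegree_C_mul_le _ _).trans (natDegree_mul_le.trans ?_)
        have h3 := (natDegree_prod_le Finset.univ
          (fun a => C (w (j.succAbove a)) + (X : ℝ[X]))).trans
          (Finset.sum_le_sum fun a _ => h2 (w (j.succAbove a)))
        simp only [Finset.sum_const, Finset.card_univ, Fintype.card_fin, smul_eq_mul,
          mul_one] at h3
        have := h1 (w j)
        omega
      · refine (natDegree_C_mul_le _ _).trans ?_
        have h3 := (natDegree_prod_le Finset.univ (fun a => C (w a) - (X : ℝ[X]))).trans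
          (Finset.sum_le_sum fun a _ => h1 (w a))
        simpa using h3
    -- the values where `x` equals another variable
    have hroot : ∀ j, p.eval (w j) = q.eval (w j) := by
      intro j
      have hq0 : q.eval (w j) = 0 := by
        rw [hqe, Finset.prod_eq_zero (Finset.mem_univ j) (sub_self _), mul_zero]
      rw [hq0]
      by_cases h0 : w j = 0
      -- here the denominator `w j + x` vanishes at `x = w j`, but so does every summand of `p`
      · rw [hpe]
        refine Finset.sum_eq_zero fun i _ => ?_
        by_cases hij : i = j
        · simp [hij]
        · obtain ⟨a, ha⟩ := Fin.exists_succAbove_eq (Ne.symm hij)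
          rw [Finset.prod_eq_zero (Finset.mem_univ a) (by rw [ha, h0, add_zero])]
          simp
      · rw [hpx, ← expand, pfaffian_eq_zero_of_swap (x := (0 : Fin (2 * N + 2))) (y := j.succ)]
        · simp
        · exact fun a b => schurKernel_antisymm _ _
        · exact (Fin.succ_ne_zero j).symm
        · have hs : ∀ i : Fin (2 * N + 2), (Fin.cons (w j) w : Fin (2 * N + 2) → ℝ)
              (Equiv.swap 0 j.succ i) = (Fin.cons (w j) w : Fin (2 * N + 2) → ℝ) i := by
            intro i
            by_cases hi0 : i = 0
            · simp [hi0]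
            · by_cases hij : i = j.succ
              · simp [hij]
              · rw [Equiv.swap_apply_of_ne_of_ne hi0 hij]
          intro a b
          exact congrArg₂ schurKernel (hs a) (hs b)
        · intro i
          by_cases hij : i = j
          · rw [hij]
            intro h
            exact h0 (by linarith)
          · exact hw2 i j hij
    -- the value at `x = -z_j`
    have hpole : ∀ j, p.eval (-w j) = q.eval (-w j) := by
      intro j
      rw [hpe, hqe, Finset.sum_eq_single j, hLK j, Fin.prod_univ_succAbove _ j]
      · have h1 : ∏ a, (w (j.succAbove a) + -w j) =
            (∏ a, schurKernel (w j) (w (j.succAbove a))) * ∏ a, (w (j.succAbove a) - -w j) := by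
          rw [← Finset.prod_mul_distrib]
          refine Finset.prod_congr rfl fun a _ => ?_
          have := hw2 _ _ (Fin.succAbove_ne j a)
          rw [schurKernel, sub_neg_eq_add]
          field_simp
          ring
        rw [h1]
        ring
      · intro i _ hij
        obtain ⟨a, ha⟩ := Fin.exists_succAbove_eq (Ne.symm hij)
        rw [Finset.prod_eq_zero (Finset.mem_univ a) (by rw [ha]; ring)]
        simp
      · simp
    have hpq : p = q := by
      by_cases hN : N = 0
      · subst hN
        have h1 : p.eval = q.eval := by
          funext x
          rw [hpe, hqe]
          simp [hK, hL]
        exact Polynomial.funext fun x => congrFun h1 x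
      -- the `2 * N + 1` points `w j` and one point `-w j₀` exceed the degree
      · obtain ⟨j₀, hj₀⟩ : ∃ j, w j ≠ 0 := by
          by_contra! h
          have h01 : (⟨0, by omega⟩ : Fin (2 * N + 1)) ≠ ⟨1, by omega⟩ := by simp
          exact hw2 _ _ h01 (by rw [h, h, add_zero])
        refine eq_of_natDegree_lt_card_of_eval_eq p q
          (f := fun o : Option (Fin (2 * N + 1)) => o.elim (-w j₀) w) ?_ ?_ ?_
        · have hne : ∀ i, w i ≠ -w j₀ := by
            intro i h
            by_cases hi : i = j₀
            · rw [hi] at h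
              exact hj₀ (by linarith)
            · exact hw2 _ _ hi (by rw [h]; ring)
          rintro (_ | i) (_ | j) h
          · rfl
          · exact absurd h.symm (hne j)
          · exact absurd h (hne i)
          · exact congrArg some (hwinj h)
        · rintro (_ | j)
          · exact hpole j₀
          · exact hroot j
        · rw [Fintype.card_option, Fintype.card_fin]
          omega
    have hzc : z = Fin.cons (z 0) w := (Fin.cons_self_tail z).symm
    have hne : ∀ j, w j + z 0 ≠ 0 := fun j => hz2 _ _ (Fin.succ_ne_zero j)
    have h1 := hpx (z 0) hne
    rw [hpq, hqe, ← expand, ← hzc] at h1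
    have h2 : ∏ j, (w j - z 0) = (∏ j, (w j + z 0)) * ∏ j, schurKernel (z 0) (w j) := by
      rw [← Finset.prod_mul_distrib]
      refine Finset.prod_congr rfl fun j _ => ?_
      rw [schurKernel, mul_div_cancel₀ _ (hne j)]
    have h3 : (∏ i : Fin (2 * N + 2), ∏ j ∈ Finset.Ioi i, schurKernel (z i) (z j)) =
        (∏ j, schurKernel (z 0) (w j)) * L := by
      rw [Fin.prod_univ_succ, Fin.prod_Ioi_zero]
      simp only [Fin.prod_Ioi_succ, hL, hw]
    refine Eq.trans ?_ h3.symm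
    refine mul_left_cancel₀ (Finset.prod_ne_zero_iff.2 fun j _ => hne j) (h1.symm.trans ?_)
    rw [h2]
    ring

end

/-! ### The entries as bilinear forms -/

section

lemma measurableSet_wedge (t : ℝ) : MeasurableSet (wedge t) :=
  (measurableSet_lt measurable_fst measurable_snd).inter
    (measurableSet_lt measurable_snd measurable_const)

lemma integrableOn_wedge_exp_mul_exp {a b : ℝ} (ha : 0 < a) (hb : 0 < b) (t : ℝ) :
    IntegrableOn (fun s : ℝ × ℝ => Real.exp (a * s.1) * Real.exp (b * s.2)) (wedge t) := by
  have h : IntegrableOn (fun s : ℝ × ℝ => Real.exp (a * s.1) * Real.exp (b * s.2))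
      (Set.Iic t ×ˢ Set.Iic t) := by
    rw [IntegrableOn, Measure.volume_eq_prod, ← Measure.prod_restrict]
    exact Integrable.mul_prod (integrableOn_exp_mul_Iic ha t) (integrableOn_exp_mul_Iic hb t)
  refine h.mono_set ?_
  rintro ⟨x, y⟩ ⟨h1, h2⟩
  exact ⟨(lt_trans h1 h2).le, h2.le⟩

lemma integral_wedge_exp_mul_exp {a b : ℝ} (ha : 0 < a) (hb : 0 < b) (t : ℝ) :
    ∫ s in wedge t, Real.exp (a * s.1) * Real.exp (b * s.2) =
      Real.exp (a * t) * Real.exp (b * t) / (a * (a + b)) := by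
  have hint := (integrable_indicator_iff (measurableSet_wedge t)).2
    (integrableOn_wedge_exp_mul_exp ha hb t)
  rw [← integral_indicator (measurableSet_wedge t), Measure.volume_eq_prod,
    integral_prod_symm _ (by rwa [Measure.volume_eq_prod] at hint)]
  have h1 : ∀ y : ℝ, ∫ x, (wedge t).indicator
      (fun s : ℝ × ℝ => Real.exp (a * s.1) * Real.exp (b * s.2)) (x, y) =
      (Set.Iio t).indicator (fun y => Real.exp ((a + b) * y) / a) y := by
    intro y
    by_cases hy : y < t
    · have h2 : (fun x => (wedge t).indicator
          (fun s : ℝ × ℝ => Real.exp (a * s.1) * Real.exp (b * s.2)) (x, y)) =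
          (Set.Iio y).indicator fun x => Real.exp (a * x) * Real.exp (b * y) := by
        funext x
        by_cases hx : x < y
        · rw [Set.indicator_of_mem (show x ∈ Set.Iio y from hx),
            Set.indicator_of_mem (show (x, y) ∈ wedge t from ⟨hx, hy⟩)]
        · rw [Set.indicator_of_notMem (show x ∉ Set.Iio y from hx),
            Set.indicator_of_notMem (show (x, y) ∉ wedge t from fun h => hx h.1)]
      rw [h2, integral_indicator measurableSet_Iio, integral_mul_const,
        ← integral_Iic_eq_integral_Iio, integral_exp_mul_Iic ha,
        Set.indicator_of_mem (show y ∈ Set.Iio t from hy), add_mul, Real.exp_add]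
      ring
    · rw [Set.indicator_of_notMem (show y ∉ Set.Iio t from hy)]
      refine integral_eq_zero_of_ae (Filter.Eventually.of_forall fun x => ?_)
      exact Set.indicator_of_notMem (fun h => hy h.2) _
  simp only [h1]
  rw [integral_indicator measurableSet_Iio, integral_div, ← integral_Iic_eq_integral_Iio,
    integral_exp_mul_Iic (add_pos ha hb), add_mul, Real.exp_add]
  field_simp

variable {n : ℕ} {ζ β : Fin n → ℝ}

lemma entryIntegrand_eq_sum (i j : ℕ) (s : ℝ × ℝ) : entryIntegrand ζ β i j s =
    ∑ a, ∑ b, β a * β b * (ζ a ^ (i + 1) * ζ b ^ (j + 1) - ζ b ^ (i + 1) * ζ a ^ (j + 1)) *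
      (Real.exp (ζ a * s.1) * Real.exp (ζ b * s.2)) := by
  rw [entryIntegrand, mul_comm (moment ζ β (i + 1) s.2)]
  simp only [moment, weight, Finset.sum_mul_sum, ← Finset.sum_sub_distrib]
  refine Finset.sum_congr rfl fun a _ => Finset.sum_congr rfl fun b _ => ?_
  ring

lemma integrableOn_entryIntegrand (hζ : ∀ j, 0 < ζ j) (i j : ℕ) (t : ℝ) :
    IntegrableOn (entryIntegrand ζ β i j) (wedge t) := by
  have h : entryIntegrand ζ β i j = fun s => ∑ a, ∑ b, β a * β b *
      (ζ a ^ (i + 1) * ζ b ^ (j + 1) - ζ b ^ (i + 1) * ζ a ^ (j + 1)) *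
      (Real.exp (ζ a * s.1) * Real.exp (ζ b * s.2)) := funext (entryIntegrand_eq_sum i j)
  rw [h]
  refine integrable_finsetSum _ fun a _ => integrable_finsetSum _ fun b _ => ?_
  exact (integrableOn_wedge_exp_mul_exp (hζ a) (hζ b) t).const_mul _

lemma entry_num_num (hζ : ∀ j, 0 < ζ j) (i j : ℕ) (t : ℝ) :
    entry ζ β t (.num i) (.num j) = ∑ a, ∑ b, (ζ a ^ i * weight ζ β a t) *
      schurKernel (ζ a) (ζ b) * (ζ b ^ j * weight ζ β b t) := by
  have h1 : entry ζ β t (.num i) (.num j) = ∑ a, ∑ b, β a * β b *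
      (ζ a ^ (i + 1) * ζ b ^ (j + 1) - ζ b ^ (i + 1) * ζ a ^ (j + 1)) *
      (Real.exp (ζ a * t) * Real.exp (ζ b * t) / (ζ a * (ζ a + ζ b))) := by
    simp only [entry, entryIntegrand_eq_sum]
    rw [integral_finsetSum]
    · refine Finset.sum_congr rfl fun a _ => ?_
      rw [integral_finsetSum]
      · refine Finset.sum_congr rfl fun b _ => ?_
        rw [integral_const_mul, integral_wedge_exp_mul_exp (hζ a) (hζ b)]
      · exact fun b _ => (integrableOn_wedge_exp_mul_exp (hζ a) (hζ b) t).const_mul _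
    · exact fun a _ => integrable_finsetSum _ fun b _ =>
        (integrableOn_wedge_exp_mul_exp (hζ a) (hζ b) t).const_mul _
  -- exchange the summation indices in the second product
  have h2 : ∑ a, ∑ b, β a * β b * (ζ b ^ (i + 1) * ζ a ^ (j + 1)) *
      (Real.exp (ζ a * t) * Real.exp (ζ b * t) / (ζ a * (ζ a + ζ b))) =
      ∑ a, ∑ b, β b * β a * (ζ a ^ (i + 1) * ζ b ^ (j + 1)) *
      (Real.exp (ζ b * t) * Real.exp (ζ a * t) / (ζ b * (ζ b + ζ a))) := Finset.sum_comm
  simp only [mul_sub, sub_mul, Finset.sum_sub_distrib] at h1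
  rw [h1, h2]
  simp only [← Finset.sum_sub_distrib]
  refine Finset.sum_congr rfl fun a _ => Finset.sum_congr rfl fun b _ => ?_
  have ha := (hζ a).ne'
  have hb := (hζ b).ne'
  have hab := (add_pos (hζ a) (hζ b)).ne'
  simp only [weight, schurKernel]
  rw [add_comm (ζ b) (ζ a)]
  field_simp
  ring

end

/-! ### Minor summation -/

section

lemma prod_sum_sum_eq_sum_prod {R ι : Type*} [CommRing R] [Fintype ι] {N : ℕ}
    (F : Fin N → ι → ι → R) : ∏ l, ∑ a, ∑ b, F l a b =
      ∑ g : Fin (2 * N) → ι,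
        ∏ l, F l (g (pairEquiv N (l, false))) (g (pairEquiv N (l, true))) := by
  classical
  have h : ∀ l, ∑ a, ∑ b, F l a b = ∑ p : ι × ι, F l p.1 p.2 := fun l =>
    (Fintype.sum_prod_type' (F l)).symm
  simp only [h, Finset.prod_univ_sum, Fintype.piFinset_univ]
  symm
  refine Fintype.sum_equiv (((Equiv.arrowCongr (pairEquiv N).symm (Equiv.refl ι)).trans
    (Equiv.curry (Fin N) Bool ι)).trans (Equiv.arrowCongr (Equiv.refl _)
      (Equiv.boolArrowEquivProd ι))) _ _ fun g => ?_
  simp [Equiv.boolArrowEquivProd, Equiv.curry, Function.curry]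

lemma prod_pairEquiv {R : Type*} [CommRing R] {N : ℕ} (f : Fin (2 * N) → R) :
    ∏ l, (f (pairEquiv N (l, false)) * f (pairEquiv N (l, true))) = ∏ x, f x := by
  rw [← Equiv.prod_comp (pairEquiv N), Fintype.prod_prod_type]
  refine Finset.prod_congr rfl fun l _ => ?_
  rw [Fintype.prod_bool, mul_comm]

/-- The Cauchy–Binet formula for the Pfaffian of `Vᵀ S V`, where `S` is Schur's array at the
nodes `z`. The sum over all choices of `2 * N` rows replaces the sum over sets of rows. -/
theorem pfaffian_transpose_schurKernel_mul {ι : Type*} [Fintype ι] (N : ℕ)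
    (V : ι → Fin (2 * N) → ℝ) (z : ι → ℝ) (hz : Function.Injective z)
    (hz2 : ∀ a b, a ≠ b → z a + z b ≠ 0) :
    ((2 * N).factorial : ℝ) *
      pfaffian N (fun i j => ∑ a, ∑ b, V a i * schurKernel (z a) (z b) * V b j) =
      ∑ g : Fin (2 * N) → ι, (Matrix.of fun i x => V (g x) i).det *
        ∏ x, ∏ y ∈ Finset.Ioi x, schurKernel (z (g x)) (z (g y)) := by
  obtain ⟨c, hc, hF⟩ := exists_sum_pfaffianTerm_eq N
  have hc' : (c : ℝ) ≠ 0 := by exact_mod_cast hc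
  set D : (Fin (2 * N) → ι) → ℝ := fun g => (Matrix.of fun i x => V (g x) i).det with hD
  set P : (Fin (2 * N) → ι) → ℝ := fun g =>
    ∏ l, schurKernel (z (g (pairEquiv N (l, false)))) (z (g (pairEquiv N (l, true)))) with hP
  have hanti : ∀ i j, (∑ a, ∑ b, V a i * schurKernel (z a) (z b) * V b j) =
      -∑ a, ∑ b, V a j * schurKernel (z a) (z b) * V b i := by
    intro i j
    rw [Finset.sum_comm, ← Finset.sum_neg_distrib]
    refine Finset.sum_congr rfl fun a _ => ?_
    rw [← Finset.sum_neg_distrib]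
    refine Finset.sum_congr rfl fun b _ => ?_
    rw [schurKernel_antisymm (z b)]
    ring
  have h1 : (c : ℝ) * pfaffian N (fun i j => ∑ a, ∑ b, V a i * schurKernel (z a) (z b) * V b j)
      = ∑ g, D g * P g := by
    rw [← hF _ hanti]
    simp only [pfaffianTerm, prod_sum_sum_eq_sum_prod
      (fun l a b => V a _ * schurKernel (z a) (z b) * V b _), Finset.mul_sum]
    rw [Finset.sum_comm]
    refine Finset.sum_congr rfl fun g _ => ?_
    rw [hD]
    simp only [Matrix.det_apply', Matrix.of_apply, Finset.sum_mul]
    refine Finset.sum_congr rfl fun σ _ => ?_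
    rw [mul_assoc, ← prod_pairEquiv fun x => V (g x) (σ x), hP, ← Finset.prod_mul_distrib]
    congr 1
    refine Finset.prod_congr rfl fun l _ => ?_
    ring
  have hDperm : ∀ (τ : Equiv.Perm (Fin (2 * N))) g,
      D (g ∘ τ) = ((Equiv.Perm.sign τ : ℤ) : ℝ) * D g := fun τ g =>
    Matrix.det_permute' τ (Matrix.of fun i x => V (g x) i)
  have h2 : ((2 * N).factorial : ℝ) * ∑ g, D g * P g =
      ∑ g, D g * ∑ τ : Equiv.Perm (Fin (2 * N)), ((Equiv.Perm.sign τ : ℤ) : ℝ) * P (g ∘ τ) := by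
    have hτ : ∀ τ : Equiv.Perm (Fin (2 * N)), ∑ g, D g * P g = ∑ g, D (g ∘ τ) * P (g ∘ τ) :=
      fun τ => (Equiv.sum_comp (Equiv.arrowCongr τ.symm (Equiv.refl ι))
        (fun g => D g * P g)).symm
    calc ((2 * N).factorial : ℝ) * ∑ g, D g * P g
        = ∑ τ : Equiv.Perm (Fin (2 * N)), ∑ g, D (g ∘ τ) * P (g ∘ τ) := by
          simp only [← hτ]
          rw [Finset.sum_const, Finset.card_univ, Fintype.card_perm, Fintype.card_fin,
            nsmul_eq_mul]
      _ = _ := by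
          rw [Finset.sum_comm]
          refine Finset.sum_congr rfl fun g _ => ?_
          rw [Finset.mul_sum]
          refine Finset.sum_congr rfl fun τ _ => ?_
          rw [hDperm]
          ring
  have h3 : ∀ g, D g * ∑ τ : Equiv.Perm (Fin (2 * N)), ((Equiv.Perm.sign τ : ℤ) : ℝ) * P (g ∘ τ) =
      c * (D g * ∏ x, ∏ y ∈ Finset.Ioi x, schurKernel (z (g x)) (z (g y))) := by
    intro g
    by_cases hg : Function.Injective g
    · rw [← pfaffian_schurKernel N (fun x => z (g x)) (hz.comp hg)
        (fun x y hxy => hz2 _ _ (hg.ne hxy)), mul_left_comm, ← hF _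
        (fun x y => schurKernel_antisymm _ _)]
      rfl
    · have h0 : D g = 0 := by
        obtain ⟨x, y, hxy, hne⟩ := Function.not_injective_iff.1 hg
        exact Matrix.det_zero_of_column_eq hne fun i => by simp [hxy]
      rw [h0]
      simp
  refine mul_left_cancel₀ hc' ?_
  rw [mul_left_comm, h1, h2, Finset.mul_sum]
  exact Finset.sum_congr rfl fun g _ => h3 g

end

/-! ### The closed form of the τ-functions -/

section

/-- The coefficient `∏ (y_j - y_i)² / (y_j + y_i)`, over all pairs `i < j`, of a product of
exponentials in the closed form of the τ-functions. It vanishes if two of the `y_i` agree. -/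
noncomputable def solitonCoeff {m : ℕ} (y : Fin m → ℝ) : ℝ :=
  ∏ i, ∏ j ∈ Finset.Ioi i, (y j - y i) ^ 2 / (y j + y i)

lemma prod_pairs_sub_mul_schurKernel {m : ℕ} (y : Fin m → ℝ) :
    (∏ i, ∏ j ∈ Finset.Ioi i, (y j - y i)) * ∏ i, ∏ j ∈ Finset.Ioi i, schurKernel (y i) (y j) =
      solitonCoeff y := by
  simp only [solitonCoeff, ← Finset.prod_mul_distrib, schurKernel]
  refine Finset.prod_congr rfl fun i _ => Finset.prod_congr rfl fun j _ => ?_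
  ring

lemma det_pow_mul {m : ℕ} (y v : Fin m → ℝ) :
    (Matrix.of fun i x : Fin m => y x ^ (i : ℕ) * v x).det =
      (∏ x, v x) * ∏ i, ∏ j ∈ Finset.Ioi i, (y j - y i) := by
  rw [← Matrix.det_vandermonde, ← Matrix.det_transpose, ← Matrix.det_mul_column]
  congr 1
  ext x i
  simp [Matrix.vandermonde_apply, mul_comm]

/-- A symmetric sum over words with exactly one letter `none` is a sum over the words in which
`none` comes first. -/
lemma sum_option_words {ι : Type*} [Fintype ι] {M : ℕ}
    (H : (Fin (M + 1) → Option ι) → ℝ)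
    (hperm : ∀ (τ : Equiv.Perm (Fin (M + 1))) g, H (g ∘ τ) = H g)
    (hsome : ∀ g, (∀ x, g x ≠ none) → H g = 0)
    (htwo : ∀ g x y, x ≠ y → g x = none → g y = none → H g = 0) :
    ∑ g, H g = ((M : ℝ) + 1) *
      ∑ g : Fin M → ι, H (Fin.cons none fun x => some (g x)) := by
  classical
  have h1 : ∀ g, H g = ∑ x, if g x = none then H g else 0 := by
    intro g
    by_cases h : ∃ x, g x = none
    · obtain ⟨x, hx⟩ := h
      rw [Finset.sum_eq_single x]
      · rw [if_pos hx]
      · intro y _ hy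
        by_cases hgy : g y = none
        · rw [if_pos hgy, htwo g y x hy hgy hx]
        · rw [if_neg hgy]
      · simp
    · push Not at h
      rw [hsome g h]
      simp
  have h2 : ∀ x : Fin (M + 1), (∑ g : Fin (M + 1) → Option ι, if g x = none then H g else 0) =
      ∑ g : Fin (M + 1) → Option ι, if g 0 = none then H g else 0 := by
    intro x
    rw [← Equiv.sum_comp (Equiv.arrowCongr (Equiv.swap 0 x) (Equiv.refl (Option ι)))
      (fun g => if g x = none then H g else 0)]
    refine Finset.sum_congr rfl fun g _ => ?_
    have e : Equiv.arrowCongr (Equiv.swap 0 x) (Equiv.refl (Option ι)) g =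
        g ∘ Equiv.swap 0 x := by
      ext; simp
    rw [e, hperm]
    simp
  have h3 : (∑ g : Fin (M + 1) → Option ι, if g 0 = none then H g else 0) =
      ∑ g : Fin M → Option ι, H (Fin.cons none g) := by
    rw [← Equiv.sum_comp (Fin.consEquiv fun _ => Option ι), Fintype.sum_prod_type,
      Fintype.sum_option]
    simp [Fin.consEquiv]
  have h4 : ∑ g : Fin M → Option ι, H (Fin.cons none g) =
      ∑ g : Fin M → ι, H (Fin.cons none fun x => some (g x)) := by
    symm
    refine Fintype.sum_of_injective (fun (g : Fin M → ι) x => some (g x)) ?_ _ _ ?_ fun g => rfl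
    · intro g g' h
      funext x
      exact Option.some_injective _ (congrFun h x)
    · intro g hg
      have : ∃ x, g x = none := by
        by_contra! h
        refine hg ⟨fun x => (g x).get (Option.isSome_iff_ne_none.2 (h x)), ?_⟩
        funext x
        simp
      obtain ⟨x, hx⟩ := this
      exact htwo _ 0 x.succ (Fin.succ_ne_zero x).symm rfl (by simpa using hx)
  calc ∑ g, H g = ∑ x : Fin (M + 1), ∑ g : Fin (M + 1) → Option ι,
        (if g x = none then H g else 0) := by
        rw [Finset.sum_comm]
        exact Finset.sum_congr rfl fun g _ => h1 g
    _ = _ := by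
        simp only [h2, h3, h4]
        simp

variable {n : ℕ} {ζ β : Fin n → ℝ}

lemma tau_two_mul (N : ℕ) (t : ℝ) : tau ζ β ((2 * N : ℕ) : ℤ) t =
    pfaffian N fun a b => entry ζ β t (.num a) (.num b) := by
  change (if Even (2 * N) then _ else _) = _
  rw [if_pos (even_two_mul N), Nat.mul_div_cancel_left N two_pos]

lemma tau_two_mul_add_one (N : ℕ) (t : ℝ) : tau ζ β ((2 * N + 1 : ℕ) : ℤ) t =
    pfaffian (N + 1) fun a b => entry ζ β t (oddWord a) (oddWord b) := by
  change (if Even (2 * N + 1) then _ else _) = _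
  have h : (2 * N + 1 + 1) / 2 = N + 1 := by omega
  rw [if_neg (by simp), h]

lemma factorial_mul_tau_even (hζ_mono : StrictMono ζ) (hζ : ∀ j, 0 < ζ j) (N : ℕ) (t : ℝ) :
    ((2 * N).factorial : ℝ) * tau ζ β ((2 * N : ℕ) : ℤ) t =
      ∑ g : Fin (2 * N) → Fin n,
        (∏ x, weight ζ β (g x) t) * solitonCoeff fun x => ζ (g x) := by
  rw [tau_two_mul]
  simp only [entry_num_num hζ]
  rw [pfaffian_transpose_schurKernel_mul N
    (fun (a : Fin n) (i : Fin (2 * N)) => ζ a ^ (i : ℕ) * weight ζ β a t) ζ hζ_mono.injective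
    fun a b _ => (add_pos (hζ a) (hζ b)).ne']
  refine Finset.sum_congr rfl fun g _ => ?_
  rw [det_pow_mul (fun x => ζ (g x)) (fun x => weight ζ β (g x) t), mul_assoc,
    prod_pairs_sub_mul_schurKernel fun x => ζ (g x)]

/-- The label `d₀` acts as one more node `0`, represented by `none`. -/
lemma entry_oddWord (hζ : ∀ j, 0 < ζ j) (i j : ℕ) (t : ℝ) :
    entry ζ β t (oddWord i) (oddWord j) = ∑ a : Option (Fin n), ∑ b : Option (Fin n),
      (a.elim (if i = 0 then 1 else 0)
        fun a => if i = 0 then 0 else ζ a ^ (i - 1) * weight ζ β a t) *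
      schurKernel (a.elim 0 ζ) (b.elim 0 ζ) *
      (b.elim (if j = 0 then 1 else 0)
        fun b => if j = 0 then 0 else ζ b ^ (j - 1) * weight ζ β b t) := by
  have h1 : ∀ a, schurKernel 0 (ζ a) = 1 := fun a => by
    simp [schurKernel, (hζ a).ne']
  have h2 : ∀ a, schurKernel (ζ a) 0 = -1 := fun a => by
    rw [schurKernel_antisymm, h1]
  rcases i with _ | i <;> rcases j with _ | j <;>
    simp [Fintype.sum_option, oddWord, entry_num_num hζ, h1, h2]
  · simp [entry, schurKernel]
  · simp [entry, moment]
  · simp [entry, moment]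

/-- The column of `d₀` is a unit vector supported at the node `none`, so only words that contain
`none` exactly once contribute; expanding along that column leaves a Vandermonde determinant, and
Schur's product does not change because `S(0, y) = 1`. -/
lemma factorial_mul_tau_odd (hζ_mono : StrictMono ζ) (hζ : ∀ j, 0 < ζ j) (N : ℕ) (t : ℝ) :
    ((2 * N + 1).factorial : ℝ) * tau ζ β ((2 * N + 1 : ℕ) : ℤ) t =
      ∑ g : Fin (2 * N + 1) → Fin n,
        (∏ x, weight ζ β (g x) t) * solitonCoeff fun x => ζ (g x) := by
  rw [tau_two_mul_add_one]
  simp only [entry_oddWord hζ]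
  set z : Option (Fin n) → ℝ := fun a => a.elim 0 ζ with hz
  set V : Option (Fin n) → Fin (2 * N + 2) → ℝ := fun a i => a.elim (if (i : ℕ) = 0 then 1 else 0)
        fun a => if (i : ℕ) = 0 then 0 else ζ a ^ ((i : ℕ) - 1) * weight ζ β a t with hV
  have hzinj : Function.Injective z := by
    rintro (_ | a) (_ | b) h
    · rfl
    · exact absurd h (hζ b).ne
    · exact absurd h (hζ a).ne'
    · exact congrArg some (hζ_mono.injective h)
  have hz2 : ∀ a b, a ≠ b → z a + z b ≠ 0 := by
    rintro (_ | a) (_ | b) h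
    · exact absurd rfl h
    · simpa [hz] using (hζ b).ne'
    · simpa [hz] using (hζ a).ne'
    · exact (add_pos (hζ a) (hζ b)).ne'
  have main := pfaffian_transpose_schurKernel_mul (N + 1) V z hzinj hz2
  set H : (Fin (2 * N + 2) → Option (Fin n)) → ℝ := fun g =>
    (Matrix.of fun i x => V (g x) i).det *
        ∏ x, ∏ y ∈ Finset.Ioi x, schurKernel (z (g x)) (z (g y)) with hH
  have hsum := sum_option_words (M := 2 * N + 1) H
    (by
      intro τ g
      have e1 : (Matrix.of fun i x => V ((g ∘ τ) x) i).det =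
          ((Equiv.Perm.sign τ : ℤ) : ℝ) * (Matrix.of fun i x => V (g x) i).det :=
        Matrix.det_permute' τ (Matrix.of fun i x => V (g x) i)
      have e2 : (∏ x, ∏ y ∈ Finset.Ioi x, schurKernel (z ((g ∘ τ) x)) (z ((g ∘ τ) y))) =
          ((Equiv.Perm.sign τ : ℤ) : ℝ) *
            ∏ x, ∏ y ∈ Finset.Ioi x, schurKernel (z (g x)) (z (g y)) :=
        Equiv.Perm.prod_Ioi_comp_eq_sign_mul_prod τ
          (f := fun x y => schurKernel (z (g x)) (z (g y))) fun x y => schurKernel_antisymm _ _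
      have e3 : ((Equiv.Perm.sign τ : ℤ) : ℝ) * ((Equiv.Perm.sign τ : ℤ) : ℝ) = 1 := by
        rw [← Int.cast_mul, ← Units.val_mul, Int.units_mul_self]
        simp
      simp only [hH]
      rw [e1, e2, mul_mul_mul_comm, e3, one_mul])
    (by
      intro g hg
      have : (Matrix.of fun i x => V (g x) i).det = 0 := by
        refine Matrix.det_eq_zero_of_row_eq_zero 0 fun x => ?_
        obtain ⟨a, ha⟩ := Option.ne_none_iff_exists'.1 (hg x)
        simp [hV, ha]
      simp only [hH, this, zero_mul])
    (by
      intro g x y hxy hx hy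
      have : (Matrix.of fun i x => V (g x) i).det = 0 :=
        Matrix.det_zero_of_column_eq hxy fun i => by simp [hx, hy]
      simp only [hH, this, zero_mul])
  have hcons : ∀ g : Fin (2 * N + 1) → Fin n, H (Fin.cons none fun x => some (g x)) =
      (∏ x, weight ζ β (g x) t) * solitonCoeff fun x => ζ (g x) := by
    intro g
    have e1 : (Matrix.of fun i x : Fin (2 * N + 2) =>
        V ((Fin.cons none fun x => some (g x) : Fin (2 * N + 2) → Option (Fin n)) x) i).det =
        (Matrix.of fun i x : Fin (2 * N + 1) => ζ (g x) ^ (i : ℕ) * weight ζ β (g x) t).det := by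
      rw [Matrix.det_succ_column_zero, Fin.sum_univ_succ, Finset.sum_eq_zero]
      · have : (Matrix.of fun i x : Fin (2 * N + 2) =>
            V ((Fin.cons none fun x => some (g x) : Fin (2 * N + 2) → Option (Fin n)) x)
              i).submatrix (Fin.succAbove 0) Fin.succ =
            Matrix.of fun i x : Fin (2 * N + 1) => ζ (g x) ^ (i : ℕ) * weight ζ β (g x) t := by
          ext i x
          simp [hV]
        rw [this]
        simp [hV]
      · intro i _
        simp [hV]
    have e2 : (∏ x : Fin (2 * N + 2), ∏ y ∈ Finset.Ioi x,
        schurKernel (z ((Fin.cons none fun x => some (g x) : Fin (2 * N + 2) → Option (Fin n)) x))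
          (z ((Fin.cons none fun x => some (g x) : Fin (2 * N + 2) → Option (Fin n)) y))) =
        ∏ x, ∏ y ∈ Finset.Ioi x, schurKernel (ζ (g x)) (ζ (g y)) := by
      rw [Fin.prod_univ_succ, Fin.prod_Ioi_zero]
      simp only [Fin.prod_Ioi_succ, Fin.cons_zero, Fin.cons_succ]
      rw [Finset.prod_eq_one, one_mul]
      · simp only [hz, Option.elim_some]
      · intro x _
        simp [hz, schurKernel, (hζ (g x)).ne']
    simp only [hH]
    rw [e1, e2, det_pow_mul (fun x => ζ (g x)) (fun x => weight ζ β (g x) t), mul_assoc,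
      prod_pairs_sub_mul_schurKernel fun x => ζ (g x)]
  simp only [hcons] at hsum
  have hM : ((2 * N + 1 : ℕ) : ℝ) + 1 ≠ 0 := by positivity
  have hfac : ((2 * (N + 1)).factorial : ℝ) =
      (((2 * N + 1 : ℕ) : ℝ) + 1) * ((2 * N + 1).factorial : ℝ) := by
    rw [show 2 * (N + 1) = (2 * N + 1) + 1 from rfl, Nat.factorial_succ]
    push_cast
    ring
  refine mul_left_cancel₀ hM ?_
  rw [← hsum, ← mul_assoc, ← hfac]
  exact main

/-- Closed form of the τ-functions: up to a factorial, a positive combination of products of the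
`b_j(t)`, summed over all words of `m` node indices. -/
theorem factorial_mul_tau (hζ_mono : StrictMono ζ) (hζ : ∀ j, 0 < ζ j) (m : ℕ) (t : ℝ) :
    (m.factorial : ℝ) * tau ζ β (m : ℤ) t =
      ∑ g : Fin m → Fin n, (∏ x, weight ζ β (g x) t) * solitonCoeff fun x => ζ (g x) := by
  rcases Nat.even_or_odd' m with ⟨N, rfl | rfl⟩
  · exact factorial_mul_tau_even hζ_mono hζ N t
  · exact factorial_mul_tau_odd hζ_mono hζ N t

end

/-! ### A polynomial identity for two-colourings -/

section

/-- The sign of a colour. -/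
def colourSign (b : Bool) : ℤ := if b then 1 else -1

/-- The signed sum of the variables for a two-colouring. -/
def signedSum {R : Type*} [CommRing R] {N : ℕ} (ε : Fin N → Bool) (y : Fin N → R) : R :=
  ∑ i, (colourSign (ε i) : R) * y i

/-- The weight of a two-colouring: `(y_j - y_i)²` for every pair of equal colours and
`y_j + y_i` for every pair of different colours. -/
def colouringWeight {R : Type*} [CommRing R] {N : ℕ} (ε : Fin N → Bool) (y : Fin N → R) : R :=
  ∏ i, ∏ j ∈ Finset.Ioi i, if ε i = ε j then (y j - y i) ^ 2 else y j + y i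

/-- The factor of a two-colouring with signed size `s` and signed sum `D` of the variables. -/
def colouringFactor {R : Type*} [CommRing R] (s : ℤ) (D : R) : R :=
  if s = 0 then D ^ 2 else if s = 2 then -2 * D else 0

/-- The sum over all two-colourings that encodes the bilinear equation of the τ-functions:
balanced colourings count with the square of the signed sum, colourings with two points more of
the first colour with `-2` times the signed sum. -/
def colouringSum {R : Type*} [CommRing R] {N : ℕ} (y : Fin N → R) : R :=
  ∑ ε : Fin N → Bool, colouringFactor (∑ i, colourSign (ε i)) (signedSum ε y) *
    colouringWeight ε y

section CommRing

variable {R : Type*} [CommRing R]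

/-- A product of a symmetric function over all pairs is invariant under permutations. -/
lemma prod_pairs_comp_perm {n : ℕ} (σ : Equiv.Perm (Fin n)) {f : Fin n → Fin n → R}
    (hf : ∀ i j, f i j = f j i) :
    ∏ i, ∏ j ∈ Finset.Ioi i, f (σ i) (σ j) = ∏ i, ∏ j ∈ Finset.Ioi i, f i j := by
  simp_rw [Finset.prod_sigma']
  set D := (Finset.univ : Finset (Fin n)).sigma Finset.Ioi with hD
  have hφD : D.image (fun x ↦ ⟨σ x.1 ⊓ σ x.2, σ x.1 ⊔ σ x.2⟩) = D := by
    ext ⟨x1, x2⟩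
    suffices (∃ a, ∃ b, a < b ∧ σ a ⊓ σ b = x1 ∧ σ a ⊔ σ b = x2) ↔ x1 < x2 by simpa [hD]
    refine ⟨?_, fun hlt ↦ ?_⟩
    · rintro ⟨i, j, hij, rfl, rfl⟩
      exact inf_le_sup.lt_of_ne <| by simp [hij.ne]
    obtain hlt' | hle := lt_or_ge (σ.symm x1) (σ.symm x2)
    · exact ⟨_, _, hlt', by simp [hlt.le]⟩
    exact ⟨_, _, hle.lt_of_ne (by simp [hlt.ne']), by simp [hlt.le]⟩
  nth_rw 2 [← hφD]
  rw [Finset.prod_image fun x hx y hy ↦ Finset.injOn_of_card_image_eq (by rw [hφD]) hx hy]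
  refine Finset.prod_congr rfl fun ⟨x₁, x₂⟩ _ ↦ ?_
  obtain hle | hle := le_total (σ x₁) (σ x₂)
  · simp [inf_eq_left.2 hle, sup_eq_right.2 hle]
  · simp [inf_eq_right.2 hle, sup_eq_left.2 hle, hf (σ x₁)]

lemma colouringWeight_comp_perm {N : ℕ} (σ : Equiv.Perm (Fin N)) (ε : Fin N → Bool)
    (y : Fin N → R) : colouringWeight (ε ∘ σ) (y ∘ σ) = colouringWeight ε y := by
  refine prod_pairs_comp_perm σ
    (f := fun i j => if ε i = ε j then (y j - y i) ^ 2 else y j + y i) fun i j => ?_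
  by_cases h : ε i = ε j
  · rw [if_pos h, if_pos h.symm]; ring
  · rw [if_neg h, if_neg (Ne.symm h)]; ring

lemma colouringSum_comp_perm {N : ℕ} (σ : Equiv.Perm (Fin N)) (y : Fin N → R) :
    colouringSum (y ∘ σ) = colouringSum y := by
  rw [colouringSum, ← Equiv.sum_comp (Equiv.arrowCongr σ.symm (Equiv.refl Bool))]
  refine Finset.sum_congr rfl fun ε _ => ?_
  have e : Equiv.arrowCongr σ.symm (Equiv.refl Bool) ε = ε ∘ σ := rfl
  have h1 : ∑ i, colourSign ((ε ∘ σ) i) = ∑ i, colourSign (ε i) :=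
    Equiv.sum_comp σ fun i => colourSign (ε i)
  have h2 : signedSum (ε ∘ σ) (y ∘ σ) = signedSum ε y :=
    Equiv.sum_comp σ fun i => (colourSign (ε i) : R) * y i
  rw [e, h1, h2, colouringWeight_comp_perm]

lemma sum_colourings_succ {N : ℕ} (F : (Fin (N + 1) → Bool) → R) :
    ∑ ε, F ε = ∑ b, ∑ ε : Fin N → Bool, F (Fin.cons b ε) := by
  rw [← Equiv.sum_comp (Fin.consEquiv fun _ => Bool), Fintype.sum_prod_type]
  rfl

lemma colouringWeight_cons {N : ℕ} (b : Bool) (ε : Fin N → Bool) (x : R) (y : Fin N → R) :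
    colouringWeight (Fin.cons b ε : Fin (N + 1) → Bool) (Fin.cons x y : Fin (N + 1) → R) =
      (∏ j, if b = ε j then (y j - x) ^ 2 else y j + x) * colouringWeight ε y := by
  rw [colouringWeight, Fin.prod_univ_succ, Fin.prod_Ioi_zero]
  simp only [Fin.prod_Ioi_succ, Fin.cons_zero, Fin.cons_succ]
  rfl

lemma signedSum_cons {N : ℕ} (b : Bool) (ε : Fin N → Bool) (x : R) (y : Fin N → R) :
    signedSum (Fin.cons b ε : Fin (N + 1) → Bool) (Fin.cons x y : Fin (N + 1) → R) =
      (colourSign b : R) * x + signedSum ε y := by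
  rw [signedSum, Fin.sum_univ_succ]
  simp only [Fin.cons_zero, Fin.cons_succ]
  rfl

lemma sum_colourSign_cons {N : ℕ} (b : Bool) (ε : Fin N → Bool) :
    ∑ i, colourSign ((Fin.cons b ε : Fin (N + 1) → Bool) i) =
      colourSign b + ∑ i, colourSign (ε i) := by
  rw [Fin.sum_univ_succ]
  simp only [Fin.cons_zero, Fin.cons_succ]

lemma colouringSum_cons {N : ℕ} (x : R) (y : Fin N → R) :
    colouringSum (Fin.cons x y : Fin (N + 1) → R) = ∑ b, ∑ ε : Fin N → Bool,
      colouringFactor (colourSign b + ∑ i, colourSign (ε i))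
        ((colourSign b : R) * x + signedSum ε y) *
      ((∏ j, if b = ε j then (y j - x) ^ 2 else y j + x) * colouringWeight ε y) := by
  rw [colouringSum, sum_colourings_succ]
  simp only [colouringWeight_cons, signedSum_cons, sum_colourSign_cons]

/-- If the first two variables agree, only colourings that separate them contribute, and the
first two variables contribute a common factor to all of these. -/
lemma colouringSum_cons_cons_self {N : ℕ} (x : R) (y : Fin N → R) (h : colouringSum y = 0) :
    colouringSum (Fin.cons x (Fin.cons x y : Fin (N + 1) → R) : Fin (N + 2) → R) = 0 := by
  have key : ∀ (b : Bool) (ε : Fin N → Bool),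
      (∏ j, if b = ε j then (y j - x) ^ 2 else y j + x) *
        (∏ j, if (!b) = ε j then (y j - x) ^ 2 else y j + x) =
      ∏ j, (y j - x) ^ 2 * (y j + x) := by
    intro b ε
    rw [← Finset.prod_mul_distrib]
    refine Finset.prod_congr rfl fun j _ => ?_
    cases b <;> cases ε j <;> simp <;> ring
  have hb : ∀ b : Bool, (∑ ε : Fin N → Bool,
      colouringFactor (colourSign b + (colourSign (!b) + ∑ i, colourSign (ε i)))
        ((colourSign b : R) * x + ((colourSign (!b) : R) * x + signedSum ε y)) *
      (((x + x) * ∏ j, if b = ε j then (y j - x) ^ 2 else y j + x) *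
        ((∏ j, if (!b) = ε j then (y j - x) ^ 2 else y j + x) * colouringWeight ε y))) = 0 := by
    intro b
    have h1 : ∀ s : ℤ, colourSign b + (colourSign (!b) + s) = s := by
      intro s; cases b <;> simp [colourSign]
    have h2 : ∀ D : R, (colourSign b : R) * x + ((colourSign (!b) : R) * x + D) = D := by
      intro D; cases b <;> simp [colourSign]
    simp only [h1, h2]
    calc _ = ((x + x) * ∏ j, (y j - x) ^ 2 * (y j + x)) * colouringSum y := by
          rw [colouringSum, Finset.mul_sum]
          refine Finset.sum_congr rfl fun ε _ => ?_
          rw [← key b ε]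
          ring
      _ = 0 := by rw [h, mul_zero]
  rw [colouringSum_cons]
  simp only [sum_colourings_succ, sum_colourSign_cons, signedSum_cons, colouringWeight_cons,
    Fin.prod_univ_succ, Fin.cons_zero, Fin.cons_succ]
  have ht := hb true
  have hf := hb false
  simp only [Bool.not_true, Bool.not_false] at ht hf
  simp only [Fintype.sum_bool, Bool.true_eq_false, Bool.false_eq_true, if_true, if_false,
    sub_self, ne_eq, OfNat.ofNat_ne_zero, not_false_eq_true, zero_pow, zero_mul, mul_zero,
    Finset.sum_const_zero, ht, hf, add_zero]

/-- The sum vanishes where two variables agree, if the sum with two variables less vanishes. -/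
lemma colouringSum_eq_zero_of_eq {N : ℕ} (h : ∀ y : Fin N → R, colouringSum y = 0)
    (y : Fin (N + 2) → R) {i j : Fin (N + 2)} (hij : i ≠ j) (hy : y i = y j) :
    colouringSum y = 0 := by
  set k := Equiv.swap 0 i j with hk
  have hk0 : k ≠ 0 := by
    intro h0
    apply hij
    have : Equiv.swap 0 i k = j := Equiv.swap_apply_self _ _ _
    rw [h0, Equiv.swap_apply_left] at this
    exact this
  set σ : Equiv.Perm (Fin (N + 2)) := Equiv.swap 0 i * Equiv.swap (Fin.succ 0) k with hσ
  have h0 : σ 0 = i := by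
    rw [hσ, Equiv.Perm.mul_apply,
      Equiv.swap_apply_of_ne_of_ne (Fin.succ_ne_zero 0).symm hk0.symm, Equiv.swap_apply_left]
  have h1 : σ (Fin.succ 0) = j := by
    rw [hσ, Equiv.Perm.mul_apply, Equiv.swap_apply_left]
    exact Equiv.swap_apply_self _ _ _
  have hcons : y ∘ σ = Fin.cons (y i) (Fin.cons (y i) fun l => y (σ l.succ.succ) :
      Fin (N + 1) → R) := by
    funext l
    refine Fin.cases ?_ (fun l => Fin.cases ?_ (fun l => ?_) l) l
    · simp [h0]
    · rw [Function.comp_apply, h1]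
      simp [hy]
    · simp
  rw [← colouringSum_comp_perm σ, hcons]
  exact colouringSum_cons_cons_self _ _ (h _)

lemma map_colouringSum {S : Type*} [CommRing S] (f : R →+* S) {N : ℕ} (y : Fin N → R) :
    f (colouringSum y) = colouringSum fun i => f (y i) := by
  simp only [colouringSum, map_sum, map_mul, colouringFactor, colouringWeight, signedSum, map_prod,
    apply_ite f, map_pow, map_sub, map_add, map_neg, map_ofNat, map_intCast, map_zero]

lemma colouringSum_two (y : Fin 2 → R) : colouringSum y = 0 := by
  simp [colouringSum, sum_colourings_succ, Fin.sum_univ_succ, Fin.prod_univ_succ, signedSum,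
    colouringWeight, colouringFactor, colourSign]
  ring

set_option maxHeartbeats 1000000 in
/-- For four variables the degree equals the number of zeros that symmetry provides, which is not
conclusive; the identity is checked by expanding it. -/
lemma colouringSum_four (y : Fin 4 → R) : colouringSum y = 0 := by
  have hy : y = Fin.cons (y 0) (Fin.cons (y 1) (Fin.cons (y 2) (Fin.cons (y 3) Fin.elim0 :
      Fin 1 → R) : Fin 2 → R) : Fin 3 → R) := by
    funext i
    fin_cases i <;> rfl
  have hW : ∀ ε : Fin 0 → Bool, colouringWeight ε (Fin.elim0 : Fin 0 → R) = 1 := fun ε => rfl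
  have hS : ∀ ε : Fin 0 → Bool, signedSum ε (Fin.elim0 : Fin 0 → R) = 0 := fun ε => rfl
  have ht : colourSign true = 1 := rfl
  have hf : colourSign false = -1 := rfl
  rw [hy]
  generalize y 0 = a
  generalize y 1 = b
  generalize y 2 = c
  generalize y 3 = d
  simp only [colouringSum, sum_colourings_succ, sum_colourSign_cons, signedSum_cons,
    colouringWeight_cons, Fintype.sum_bool, Fin.prod_univ_succ, Fin.cons_zero, Fin.cons_succ, hW,
    hS, ht, hf, Finset.univ_eq_empty, Finset.prod_empty, reduceCtorEq, if_true, if_false]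
  norm_num [colouringFactor]
  ring

end CommRing

end

section

open Polynomial in
/-- In a balanced colouring the first variable has `m` equals among the other `2 * m + 1`, which
bounds the degree by `2 * m + (m + 1) + 2`; the unbalanced colourings give no more. -/
lemma natDegree_colouringSum_cons_X_le {m : ℕ} (w : Fin (2 * m + 1) → ℝ) :
    (colouringSum (Fin.cons X (fun j => C (w j)) : Fin (2 * m + 2) → ℝ[X])).natDegree
      ≤ 3 * m + 3 := by
  rw [colouringSum_cons]
  refine natDegree_sum_le_of_forall_le _ _ fun b _ =>
    natDegree_sum_le_of_forall_le _ _ fun ε _ => ?_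
  -- the number of other points of the same colour, each of which contributes a square
  set k : ℕ := (Finset.univ.filter fun j => b = ε j).card with hk
  have hsize : colourSign b * (colourSign b + ∑ i, colourSign (ε i)) = 2 * k - 2 * m := by
    have h1 : ∀ j, colourSign b * colourSign (ε j) = 2 * (if b = ε j then 1 else 0) - 1 := by
      intro j
      cases b <;> cases ε j <;> simp [colourSign]
    have h2 : colourSign b * colourSign b = 1 := by cases b <;> simp [colourSign]
    rw [mul_add, h2, Finset.mul_sum]
    simp only [h1]
    rw [Finset.sum_sub_distrib, ← Finset.mul_sum, Finset.sum_boole]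
    simp only [Finset.sum_const, Finset.card_univ, Fintype.card_fin, hk]
    ring
  have hprod : (∏ j, if b = ε j then (C (w j) - X) ^ 2 else C (w j) + X : ℝ[X]).natDegree ≤
      2 * m + 1 + k := by
    refine (natDegree_prod_le _ _).trans ((Finset.sum_le_sum
      (g := fun j => 1 + if b = ε j then 1 else 0) fun j _ => ?_).trans ?_)
    · split_ifs
      · have h1 : (C (w j) - X : ℝ[X]).natDegree ≤ 1 := (natDegree_sub_le _ _).trans (by simp)
        exact natDegree_pow_le.trans (Nat.mul_le_mul_left 2 h1)
      · exact (natDegree_add_le _ _).trans (by simp)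
    · rw [Finset.sum_add_distrib, Finset.sum_boole]
      simp [hk]
  have hweight : (colouringWeight ε fun j => C (w j)).natDegree = 0 := by
    have : (colouringWeight ε fun j => C (w j)) = C (colouringWeight ε w) := by
      simp only [colouringWeight, map_prod, apply_ite C, map_pow, map_sub, map_add]
    rw [this, natDegree_C]
  have hlin : ((colourSign b : ℝ[X]) * X + signedSum ε fun j => C (w j)).natDegree ≤ 1 := by
    have : (signedSum ε fun j => C (w j)) = C (signedSum ε w) := by
      simp only [signedSum, map_sum, map_mul, map_intCast]
    rw [this]
    refine (natDegree_add_le _ _).trans (max_le ?_ (by simp))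
    exact natDegree_mul_le.trans (by simp)
  have hrest : ((∏ j, if b = ε j then (C (w j) - X) ^ 2 else C (w j) + X : ℝ[X]) *
      colouringWeight ε fun j => C (w j)).natDegree ≤ 2 * m + 1 + k :=
    natDegree_mul_le.trans (by omega)
  have hk2 : colourSign b = 1 ∨ colourSign b = -1 := by cases b <;> simp [colourSign]
  unfold colouringFactor
  split_ifs with h0 h1
  · rw [h0] at hsize
    refine natDegree_mul_le.trans ?_
    have := (natDegree_pow_le (p := (colourSign b : ℝ[X]) * X + signedSum ε fun j => C (w j))
      (n := 2)).trans (Nat.mul_le_mul_left 2 hlin)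
    omega
  · rw [h1] at hsize
    refine natDegree_mul_le.trans ?_
    have : (-2 * ((colourSign b : ℝ[X]) * X + signedSum ε fun j => C (w j))).natDegree ≤ 1 := by
      have e : (-2 : ℝ[X]) = C (-2) := by rw [map_neg, map_ofNat]
      rw [e]
      exact (natDegree_C_mul_le _ _).trans hlin
    have : k ≤ m + 1 := by
      rcases hk2 with h | h <;> rw [h] at hsize <;> omega
    omega
  · simp

lemma differentiable_colouringSum (N : ℕ) :
    Differentiable ℝ (colouringSum : (Fin N → ℝ) → ℝ) := by
  unfold colouringSum
  refine Differentiable.fun_sum fun ε _ => Differentiable.mul ?_ ?_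
  · have h : Differentiable ℝ fun y : Fin N → ℝ => signedSum ε y := by
      unfold signedSum
      fun_prop
    unfold colouringFactor
    split_ifs
    · exact h.pow 2
    · exact h.const_mul _
    · exact differentiable_const _
  · unfold colouringWeight
    have h : ∀ i j : Fin N, Differentiable ℝ fun y : Fin N → ℝ =>
        if ε i = ε j then (y j - y i) ^ 2 else y j + y i := by
      intro i j
      split_ifs <;> fun_prop
    fun_prop

/-- A symmetric function that vanishes where two variables agree also has vanishing derivative
in these two variables there. -/
lemma hasDerivAt_colouringSum_cons {N : ℕ} (h : ∀ y : Fin N → ℝ, colouringSum y = 0)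
    (w : Fin (N + 1) → ℝ) (j : Fin (N + 1)) :
    HasDerivAt (fun x => colouringSum (Fin.cons x w : Fin (N + 2) → ℝ)) 0 (w j) := by
  set y₀ : Fin (N + 2) → ℝ := Fin.cons (w j) w with hy₀
  set L := fderiv ℝ (colouringSum : (Fin (N + 2) → ℝ) → ℝ) y₀ with hL
  have hline : ∀ v : Fin (N + 2) → ℝ,
      HasDerivAt (fun s : ℝ => colouringSum (y₀ + s • v)) (L v) 0 := by
    intro v
    have h1 : HasDerivAt (fun s : ℝ => y₀ + s • v) v 0 := by
      simpa using ((hasDerivAt_id (0 : ℝ)).smul_const v).const_add y₀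
    have h2 : HasFDerivAt (colouringSum : (Fin (N + 2) → ℝ) → ℝ) L (y₀ + (0 : ℝ) • v) := by
      rw [zero_smul, add_zero]
      exact (differentiable_colouringSum _ y₀).hasFDerivAt
    exact h2.comp_hasDerivAt (0 : ℝ) h1
  set e₀ : Fin (N + 2) → ℝ := Pi.single 0 1 with he₀
  set e₁ : Fin (N + 2) → ℝ := Pi.single j.succ 1 with he₁
  have hne : (0 : Fin (N + 2)) ≠ j.succ := (Fin.succ_ne_zero j).symm
  have hyj : y₀ j.succ = y₀ 0 := by simp [hy₀]
  have hdiag : L (e₀ + e₁) = 0 := by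
    have h1 := hline (e₀ + e₁)
    have h2 : (fun s : ℝ => colouringSum (y₀ + s • (e₀ + e₁))) = fun _ => 0 := by
      funext s
      refine colouringSum_eq_zero_of_eq h _ hne ?_
      simp [he₀, he₁, hyj, hne, hne.symm]
    rw [h2] at h1
    exact h1.unique (hasDerivAt_const _ _)
  have hswap : L e₀ = L e₁ := by
    have h1 := hline e₀
    have h2 : (fun s : ℝ => colouringSum (y₀ + s • e₀)) =
        fun s : ℝ => colouringSum (y₀ + s • e₁) := by
      funext s
      rw [← colouringSum_comp_perm (Equiv.swap 0 j.succ) (y₀ + s • e₀)]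
      congr 1
      funext i
      by_cases hi0 : i = 0
      · subst hi0
        simp [he₀, he₁, hyj, hne, hne.symm]
      · by_cases hij : i = j.succ
        · subst hij
          simp [he₀, he₁, hyj]
        · simp [Equiv.swap_apply_of_ne_of_ne hi0 hij, he₀, he₁, hi0, hij]
    rw [h2] at h1
    exact h1.unique (hline e₁)
  have hL0 : L e₀ = 0 := by
    rw [map_add, ← hswap] at hdiag
    linarith
  have h1 := hline e₀
  rw [hL0] at h1
  have h2 : (fun x => colouringSum (Fin.cons x w : Fin (N + 2) → ℝ)) =
      (fun s : ℝ => colouringSum (y₀ + s • e₀)) ∘ fun x => x - w j := by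
    funext x
    rw [Function.comp_apply]
    congr 1
    funext i
    refine Fin.cases ?_ (fun i => ?_) i
    · simp [hy₀, he₀]
    · simp [hy₀, he₀]
  rw [h2]
  have h3 : HasDerivAt (fun x => x - w j) 1 (w j) := (hasDerivAt_id _).sub_const _
  have h4 := HasDerivAt.comp (w j) (h₂ := fun s : ℝ => colouringSum (y₀ + s • e₀)) (h₂' := 0)
    (by rwa [sub_self]) h3
  simpa using h4

open Polynomial in
/-- The sum over colourings vanishes identically. By induction on the number of variables it has
a double zero wherever two variables agree, and for six or more variables its degree in one
variable is too small for so many zeros. -/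
theorem colouringSum_eq_zero : ∀ (m : ℕ) (y : Fin (2 * m) → ℝ), colouringSum y = 0
  | 0, y => by simp [colouringSum, colouringFactor, signedSum]
  | 1, y => colouringSum_two y
  | 2, y => colouringSum_four y
  | m + 3, y => by
    have ih := colouringSum_eq_zero (m + 2)
    change Fin (2 * (m + 2) + 2) → ℝ at y
    by_cases hy : Function.Injective y
    swap
    · obtain ⟨i, j, hij, hne⟩ := Function.not_injective_iff.1 hy
      exact colouringSum_eq_zero_of_eq ih y hne hij
    set w : Fin (2 * (m + 2) + 1) → ℝ := fun j => y j.succ with hw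
    have hwinj : Function.Injective w := hy.comp (Fin.succ_injective _)
    set p : ℝ[X] := colouringSum
      (Fin.cons X (fun j => C (w j)) : Fin (2 * (m + 2) + 2) → ℝ[X]) with hp
    have hpe : ∀ x, p.eval x =
        colouringSum (Fin.cons x w : Fin (2 * (m + 2) + 2) → ℝ) := by
      intro x
      have := map_colouringSum (evalRingHom x)
        (Fin.cons X (fun j => C (w j)) : Fin (2 * (m + 2) + 2) → ℝ[X])
      rw [coe_evalRingHom] at this
      rw [hp, this]
      congr 1
      funext i
      refine Fin.cases ?_ (fun i => ?_) i <;> simp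
    have hp0 : p = 0 := by
      by_contra hne
      have hdvd : ∀ j ∈ Finset.univ, (X - C (w j)) ^ 2 ∣ p := by
        intro j _
        rw [← le_rootMultiplicity_iff hne]
        refine (one_lt_rootMultiplicity_iff_isRoot hne).2 ⟨?_, ?_⟩
        · rw [IsRoot.def, hpe]
          exact colouringSum_eq_zero_of_eq ih _ (Fin.succ_ne_zero j).symm (by simp)
        · rw [IsRoot.def]
          have h1 := p.hasDerivAt (w j)
          simp only [hpe] at h1
          exact h1.unique (hasDerivAt_colouringSum_cons ih w j)
      have hprod : ∏ j, (X - C (w j)) ^ 2 ∣ p := by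
        refine Finset.prod_dvd_of_coprime (fun i _ j _ hij => ?_) hdvd
        exact (isCoprime_X_sub_C_of_isUnit_sub
          (sub_ne_zero.2 (hwinj.ne hij)).isUnit).pow
      have h1 := natDegree_le_of_dvd hprod hne
      have h2 : (∏ j, (X - C (w j)) ^ 2).natDegree = 2 * (2 * (m + 2) + 1) := by
        rw [natDegree_prod _ _ fun j _ => pow_ne_zero _ (X_sub_C_ne_zero _)]
        simp [mul_comm]
      have h3 : p.natDegree ≤ 3 * (m + 2) + 3 := natDegree_colouringSum_cons_X_le w
      omega
    have hyc : y = Fin.cons (y 0) w := (Fin.cons_self_tail y).symm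
    have h1 := hpe (y 0)
    rw [hp0, eval_zero, ← hyc] at h1
    exact h1.symm

end

/-! ### The bilinear equation -/

section

/-- The `r`-th derivative of the τ-function in its closed form: each word `g` of node indices
contributes an exponential of rate `∑ ζ_{g x}`. -/
noncomputable def tauMoment {n : ℕ} (ζ β : Fin n → ℝ) (r m : ℕ) (t : ℝ) : ℝ :=
  (∑ g : Fin m → Fin n, (∑ x, ζ (g x)) ^ r *
    ((∏ x, weight ζ β (g x) t) * solitonCoeff fun x => ζ (g x))) / m.factorial

/-- If the points are split by a two-colouring, a product over the pairs of equal colour is the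
product of the two products over the pairs in one colour class. -/
lemma prod_pairs_colouring {R : Type*} [CommRing R] {N a b : ℕ} (ε : Fin N → Bool)
    (e : Fin a ⊕ Fin b ≃ Fin N) (hl : StrictMono (e ∘ Sum.inl)) (hr : StrictMono (e ∘ Sum.inr))
    (hεl : ∀ x, ε (e (Sum.inl x)) = true) (hεr : ∀ x, ε (e (Sum.inr x)) = false)
    (f : Fin N → Fin N → R) :
    (∏ i, ∏ j ∈ Finset.Ioi i, if ε i = ε j then f i j else 1) =
      (∏ i, ∏ j ∈ Finset.Ioi i, f (e (Sum.inl i)) (e (Sum.inl j))) *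
        ∏ i, ∏ j ∈ Finset.Ioi i, f (e (Sum.inr i)) (e (Sum.inr j)) := by
  have hI : ∀ {n : ℕ} (i : Fin n) (F : Fin n → R),
      ∏ j ∈ Finset.Ioi i, F j = ∏ j, if i < j then F j else 1 := by
    intro n i F
    rw [← Finset.prod_filter]
    congr 1
    ext j
    simp
  have hl' : ∀ i j, e (Sum.inl i) < e (Sum.inl j) ↔ i < j := fun i j => hl.lt_iff_lt
  have hr' : ∀ i j, e (Sum.inr i) < e (Sum.inr j) ↔ i < j := fun i j => hr.lt_iff_lt
  simp only [hI]
  rw [← Equiv.prod_comp e]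
  simp only [← Equiv.prod_comp e (fun j => if _ < j then _ else (1 : R)), Fintype.prod_sum_type]
  simp [hl', hr', hεl, hεr]

variable {n : ℕ} {ζ β : Fin n → ℝ}

lemma colouringWeight_div {N : ℕ} (ε : Fin N → Bool) (y : Fin N → ℝ) (hy : ∀ i, 0 < y i) :
    colouringWeight ε y / (∏ i, ∏ j ∈ Finset.Ioi i, (y j + y i)) =
      ∏ i, ∏ j ∈ Finset.Ioi i, if ε i = ε j then (y j - y i) ^ 2 / (y j + y i) else 1 := by
  simp only [colouringWeight, ← Finset.prod_div_distrib]
  refine Finset.prod_congr rfl fun i _ => Finset.prod_congr rfl fun j _ => ?_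
  split_ifs
  · rfl
  · exact div_self (add_pos (hy j) (hy i)).ne'

/-- The contribution of one colouring, summed over all words of length `N`, splits into a double
sum over the words in the two colour classes. -/
lemma sum_words_colouring (hζ : ∀ j, 0 < ζ j) (t : ℝ) {N a b : ℕ} (ε : Fin N → Bool)
    (ha : (Finset.univ.filter fun i => ε i = true).card = a)
    (hb : (Finset.univ.filter fun i => ε i = true)ᶜ.card = b) (Φ : ℝ → ℝ) :
    ∑ G : Fin N → Fin n, (∏ x, weight ζ β (G x) t) *
        (Φ (signedSum ε fun i => ζ (G i)) * (colouringWeight ε (fun i => ζ (G i)) /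
          ∏ i, ∏ j ∈ Finset.Ioi i, (ζ (G j) + ζ (G i)))) =
      ∑ g : Fin a → Fin n, ∑ h : Fin b → Fin n,
        ((∏ x, weight ζ β (g x) t) * solitonCoeff fun x => ζ (g x)) *
        ((∏ x, weight ζ β (h x) t) * solitonCoeff fun x => ζ (h x)) *
        Φ (∑ x, ζ (g x) - ∑ x, ζ (h x)) := by
  set e : Fin a ⊕ Fin b ≃ Fin N := finSumEquivOfFinset ha hb with he
  have hl : StrictMono (e ∘ Sum.inl) := by
    intro i j hij
    simpa [he] using hij
  have hr : StrictMono (e ∘ Sum.inr) := by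
    intro i j hij
    simpa [he] using hij
  have hεl : ∀ x, ε (e (Sum.inl x)) = true := by
    intro x
    exact (Finset.mem_filter.1 (Finset.orderEmbOfFin_mem _ ha x)).2
  have hεr : ∀ x, ε (e (Sum.inr x)) = false := by
    intro x
    have h := Finset.mem_compl.1 (Finset.orderEmbOfFin_mem _ hb x)
    by_contra h'
    exact h (Finset.mem_filter.2 ⟨Finset.mem_univ _, (Bool.not_eq_false _).mp h'⟩)
  rw [← Fintype.sum_prod_type']
  refine Fintype.sum_equiv ((Equiv.arrowCongr e.symm (Equiv.refl (Fin n))).trans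
    (Equiv.sumArrowEquivProdArrow (Fin a) (Fin b) (Fin n))) _ _ fun G => ?_
  have h1 : ∏ x, weight ζ β (G x) t = (∏ x, weight ζ β (G (e (Sum.inl x))) t) *
      ∏ x, weight ζ β (G (e (Sum.inr x))) t := by
    rw [← Equiv.prod_comp e, Fintype.prod_sum_type]
  have h2 : (signedSum ε fun i => ζ (G i)) =
      ∑ x, ζ (G (e (Sum.inl x))) - ∑ x, ζ (G (e (Sum.inr x))) := by
    rw [signedSum, ← Equiv.sum_comp e, Fintype.sum_sum_type]
    simp [hεl, hεr, colourSign, sub_eq_add_neg]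
  rw [colouringWeight_div ε (fun i => ζ (G i)) fun i => hζ _,
    prod_pairs_colouring ε e hl hr hεl hεr
      fun i j => (ζ (G j) - ζ (G i)) ^ 2 / (ζ (G j) + ζ (G i)), h1, h2]
  change _ = ((∏ x, weight ζ β (G (e (Sum.inl x))) t) *
      solitonCoeff fun x => ζ (G (e (Sum.inl x)))) *
    ((∏ x, weight ζ β (G (e (Sum.inr x))) t) * solitonCoeff fun x => ζ (G (e (Sum.inr x)))) *
    Φ (∑ x, ζ (G (e (Sum.inl x))) - ∑ x, ζ (G (e (Sum.inr x))))
  simp only [solitonCoeff]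
  ring

lemma card_colourings (N a : ℕ) : (Finset.univ.filter fun ε : Fin N → Bool =>
    (Finset.univ.filter fun i => ε i = true).card = a).card = N.choose a := by
  have h := Finset.card_powersetCard a (Finset.univ : Finset (Fin N))
  rw [Finset.card_univ, Fintype.card_fin] at h
  rw [← h]
  refine Finset.card_nbij' (fun ε => Finset.univ.filter fun i => ε i = true)
    (fun s i => decide (i ∈ s)) ?_ ?_ ?_ ?_
  · intro ε hε
    simpa [Finset.mem_powersetCard] using hε
  · intro s hs
    simpa [Finset.mem_powersetCard] using hs
  · intro ε _
    funext i
    simp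
  · intro s _
    ext i
    simp

lemma sum_colourSign {N : ℕ} (ε : Fin N → Bool) : ∑ i, colourSign (ε i) =
    2 * ((Finset.univ.filter fun i => ε i = true).card : ℤ) - N := by
  have h : ∀ i, colourSign (ε i) = 2 * (if ε i = true then 1 else 0) - 1 := by
    intro i
    cases ε i <;> simp [colourSign]
  simp only [h]
  rw [Finset.sum_sub_distrib, ← Finset.mul_sum, Finset.sum_boole]
  simp

/-- The bilinear equation `τ_k'' τ_k - τ_k'² = τ_{k+1}' τ_{k-1} - τ_{k+1} τ_{k-1}'`, for
`k = l + 1`. Each side is a sum over words of length `2 * k` split into two parts; by symmetry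
all splittings may be averaged, which makes the summand a `colouringSum`. -/
theorem tauMoment_bilinear (hζ : ∀ j, 0 < ζ j) (l : ℕ) (t : ℝ) :
    tauMoment ζ β 2 (l + 1) t * tauMoment ζ β 0 (l + 1) t - tauMoment ζ β 1 (l + 1) t ^ 2 =
      tauMoment ζ β 1 (l + 2) t * tauMoment ζ β 0 l t -
        tauMoment ζ β 0 (l + 2) t * tauMoment ζ β 1 l t := by
  set B : (m : ℕ) → (Fin m → Fin n) → ℝ := fun _ g =>
    (∏ x, weight ζ β (g x) t) * solitonCoeff fun x => ζ (g x) with hB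
  set Z : (m : ℕ) → (Fin m → Fin n) → ℝ := fun _ g => ∑ x, ζ (g x) with hZ
  set X₀ : ℝ := ∑ g : Fin (l + 1) → Fin n, ∑ h : Fin (l + 1) → Fin n,
    B _ g * B _ h * (Z _ g - Z _ h) ^ 2 with hX₀
  set X₂ : ℝ := ∑ g : Fin (l + 2) → Fin n, ∑ h : Fin l → Fin n,
    B _ g * B _ h * (-2 * (Z _ g - Z _ h)) with hX₂
  -- averaging over all splittings of words of length `2 * (l + 1)`
  have hzero : ∑ ε : Fin (2 * (l + 1)) → Bool, ∑ G : Fin (2 * (l + 1)) → Fin n,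
      (∏ x, weight ζ β (G x) t) *
        (colouringFactor (∑ i, colourSign (ε i)) (signedSum ε fun i => ζ (G i)) *
          (colouringWeight ε (fun i => ζ (G i)) /
            ∏ i, ∏ j ∈ Finset.Ioi i, (ζ (G j) + ζ (G i)))) = 0 := by
    rw [Finset.sum_comm]
    refine Finset.sum_eq_zero fun G _ => ?_
    have h := colouringSum_eq_zero (l + 1) fun i => ζ (G i)
    rw [← Finset.mul_sum]
    simp only [← mul_div_assoc]
    rw [← Finset.sum_div]
    change _ * (colouringSum (fun i => ζ (G i)) / _) = 0
    rw [h, zero_div, mul_zero]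
  have hterm : ∀ ε : Fin (2 * (l + 1)) → Bool, (∑ G : Fin (2 * (l + 1)) → Fin n,
      (∏ x, weight ζ β (G x) t) *
        (colouringFactor (∑ i, colourSign (ε i)) (signedSum ε fun i => ζ (G i)) *
          (colouringWeight ε (fun i => ζ (G i)) /
            ∏ i, ∏ j ∈ Finset.Ioi i, (ζ (G j) + ζ (G i))))) =
      (if (Finset.univ.filter fun i => ε i = true).card = l + 1 then X₀ else 0) +
        if (Finset.univ.filter fun i => ε i = true).card = l + 2 then X₂ else 0 := by
    intro ε
    have hs := sum_colourSign ε
    have hcompl := Finset.card_compl (Finset.univ.filter fun i => ε i = true)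
    rw [Fintype.card_fin] at hcompl
    by_cases h1 : (Finset.univ.filter fun i => ε i = true).card = l + 1
    · have h2 : ∑ i, colourSign (ε i) = 0 := by rw [hs, h1]; push_cast; ring
      rw [if_pos h1, if_neg (by omega), add_zero, h2]
      exact sum_words_colouring hζ t ε h1 (by omega) fun D => D ^ 2
    · by_cases h3 : (Finset.univ.filter fun i => ε i = true).card = l + 2
      · have h2 : ∑ i, colourSign (ε i) = 2 := by rw [hs, h3]; push_cast; ring
        rw [if_neg h1, if_pos h3, zero_add, h2]
        exact sum_words_colouring hζ t ε h3 (by omega) fun D => -2 * D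
      · rw [if_neg h1, if_neg h3, add_zero]
        refine Finset.sum_eq_zero fun G _ => ?_
        rw [colouringFactor, if_neg (by push_cast at hs; omega),
          if_neg (by push_cast at hs; omega)]
        simp
  simp only [hterm] at hzero
  rw [Finset.sum_add_distrib, ← Finset.sum_filter, ← Finset.sum_filter, Finset.sum_const,
    Finset.sum_const, card_colourings, card_colourings, nsmul_eq_mul, nsmul_eq_mul] at hzero
  have hS : ∀ r m, tauMoment ζ β r m t = (∑ g : Fin m → Fin n, Z _ g ^ r * B _ g) / m.factorial :=
    fun r m => rfl
  set S : ℕ → ℕ → ℝ := fun r m => ∑ g : Fin m → Fin n, Z _ g ^ r * B _ g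
  have hSS : ∀ r m r' m', S r m * S r' m' = ∑ g : Fin m → Fin n, ∑ h : Fin m' → Fin n,
      (Z _ g ^ r * B _ g) * (Z _ h ^ r' * B _ h) := fun r m r' m' => Finset.sum_mul_sum _ _ _ _
  have hX₀' : X₀ = 2 * (S 2 (l + 1) * S 0 (l + 1) - S 1 (l + 1) ^ 2) := by
    have e1 : X₀ = S 2 (l + 1) * S 0 (l + 1) - 2 * (S 1 (l + 1) * S 1 (l + 1)) +
        S 0 (l + 1) * S 2 (l + 1) := by
      simp only [hX₀, hSS, Finset.mul_sum, ← Finset.sum_sub_distrib,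
        ← Finset.sum_add_distrib]
      refine Finset.sum_congr rfl fun g _ => Finset.sum_congr rfl fun h _ => ?_
      ring
    rw [e1]
    ring
  have hX₂' : X₂ = -2 * (S 1 (l + 2) * S 0 l - S 0 (l + 2) * S 1 l) := by
    simp only [hX₂, hSS, Finset.mul_sum, ← Finset.sum_sub_distrib]
    refine Finset.sum_congr rfl fun g _ => Finset.sum_congr rfl fun h _ => ?_
    ring
  have hc1 : ((2 * (l + 1)).choose (l + 1) : ℝ) * ((l + 1).factorial * (l + 1).factorial) =
      (2 * (l + 1)).factorial := by
    have := Nat.choose_mul_factorial_mul_factorial (show l + 1 ≤ 2 * (l + 1) by omega)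
    rw [show 2 * (l + 1) - (l + 1) = l + 1 by omega, mul_assoc] at this
    exact_mod_cast this
  have hc2 : ((2 * (l + 1)).choose (l + 2) : ℝ) * ((l + 2).factorial * l.factorial) =
      (2 * (l + 1)).factorial := by
    have := Nat.choose_mul_factorial_mul_factorial (show l + 2 ≤ 2 * (l + 1) by omega)
    rw [show 2 * (l + 1) - (l + 2) = l by omega, mul_assoc] at this
    exact_mod_cast this
  have hf0 : (l.factorial : ℝ) ≠ 0 := by exact_mod_cast l.factorial_ne_zero
  have hf1 : ((l + 1).factorial : ℝ) ≠ 0 := by exact_mod_cast (l + 1).factorial_ne_zero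
  have hf2 : ((l + 2).factorial : ℝ) ≠ 0 := by exact_mod_cast (l + 2).factorial_ne_zero
  have hf : ((2 * (l + 1)).factorial : ℝ) ≠ 0 := by exact_mod_cast (2 * (l + 1)).factorial_ne_zero
  rw [hX₀', hX₂'] at hzero
  have hd1 : ((2 * (l + 1)).choose (l + 1) : ℝ) =
      (2 * (l + 1)).factorial / ((l + 1).factorial * (l + 1).factorial) := by
    rw [eq_div_iff (mul_ne_zero hf1 hf1), hc1]
  have hd2 : ((2 * (l + 1)).choose (l + 2) : ℝ) =
      (2 * (l + 1)).factorial / ((l + 2).factorial * l.factorial) := by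
    rw [eq_div_iff (mul_ne_zero hf2 hf0), hc2]
  rw [hd1, hd2] at hzero
  simp only [hS]
  change S 2 (l + 1) / _ * (S 0 (l + 1) / _) - (S 1 (l + 1) / _) ^ 2 =
    S 1 (l + 2) / _ * (S 0 l / _) - S 0 (l + 2) / _ * (S 1 l / _)
  refine mul_left_cancel₀ (mul_ne_zero two_ne_zero hf) ?_
  rw [← sub_eq_zero, ← hzero]
  field_simp
  ring

end

/-! ### Positivity, derivatives and the lattice -/

section

variable {n : ℕ} {ζ β : Fin n → ℝ}

lemma tau_eq_tauMoment (hζ_mono : StrictMono ζ) (hζ : ∀ j, 0 < ζ j) (m : ℕ) :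
    tau ζ β (m : ℤ) = tauMoment ζ β 0 m := by
  funext t
  have hf : (m.factorial : ℝ) ≠ 0 := by exact_mod_cast m.factorial_ne_zero
  rw [tauMoment, eq_div_iff hf, mul_comm, factorial_mul_tau hζ_mono hζ]
  simp

lemma hasDerivAt_tauMoment (r m : ℕ) (t : ℝ) :
    HasDerivAt (tauMoment ζ β r m) (tauMoment ζ β (r + 1) m t) t := by
  have hexp : ∀ g : Fin m → Fin n, (fun t => ∏ x, weight ζ β (g x) t) =
      fun t => (∏ x, β (g x)) * Real.exp ((∑ x, ζ (g x)) * t) := by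
    intro g
    funext t
    simp only [weight]
    rw [Finset.prod_mul_distrib, Finset.sum_mul, Real.exp_sum]
  have hword : ∀ g : Fin m → Fin n, HasDerivAt (fun t => ∏ x, weight ζ β (g x) t)
      ((∑ x, ζ (g x)) * ∏ x, weight ζ β (g x) t) t := by
    intro g
    rw [congrFun (hexp g) t, hexp g]
    have h := (((hasDerivAt_id t).const_mul (∑ x, ζ (g x))).exp).const_mul (∏ x, β (g x))
    refine h.congr_deriv ?_
    simp only [id, mul_one]
    ring
  unfold tauMoment
  refine (HasDerivAt.fun_sum (A' := fun g : Fin m → Fin n => (∑ x, ζ (g x)) ^ (r + 1) *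
    ((∏ x, weight ζ β (g x) t) * solitonCoeff fun x => ζ (g x))) fun g _ => ?_).div_const _
  refine (((hword g).mul_const (solitonCoeff fun x => ζ (g x))).const_mul
    ((∑ x, ζ (g x)) ^ r)).congr_deriv ?_
  ring

lemma solitonCoeff_eq_zero {m : ℕ} {y : Fin m → ℝ} {i j : Fin m} (hij : i ≠ j) (h : y i = y j) :
    solitonCoeff y = 0 := by
  wlog hlt : i < j generalizing i j
  · exact this hij.symm h.symm (lt_of_le_of_ne (not_lt.1 hlt) hij.symm)
  refine Finset.prod_eq_zero (Finset.mem_univ i)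
    (Finset.prod_eq_zero (Finset.mem_Ioi.2 hlt) ?_)
  simp [h]

lemma solitonCoeff_nonneg {m : ℕ} {y : Fin m → ℝ} (hy : ∀ i, 0 < y i) : 0 ≤ solitonCoeff y :=
  Finset.prod_nonneg fun i _ => Finset.prod_nonneg fun j _ =>
    div_nonneg (sq_nonneg _) (add_pos (hy j) (hy i)).le

lemma solitonCoeff_pos {m : ℕ} {y : Fin m → ℝ} (hy : ∀ i, 0 < y i) (hinj : Function.Injective y) :
    0 < solitonCoeff y :=
  Finset.prod_pos fun i _ => Finset.prod_pos fun j hj =>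
    div_pos (sq_pos_of_ne_zero (sub_ne_zero.2 (hinj.ne (Finset.mem_Ioi.1 hj).ne')))
      (add_pos (hy j) (hy i))

lemma weight_pos (hβ : ∀ j, 0 < β j) (j : Fin n) (t : ℝ) : 0 < weight ζ β j t :=
  mul_pos (hβ j) (Real.exp_pos _)

lemma tauMoment_zero_pos (hζ_mono : StrictMono ζ) (hζ : ∀ j, 0 < ζ j) (hβ : ∀ j, 0 < β j)
    {m : ℕ} (hm : m ≤ n) (t : ℝ) : 0 < tauMoment ζ β 0 m t := by
  refine div_pos ?_ (by exact_mod_cast m.factorial_pos)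
  refine Finset.sum_pos' (fun g _ => ?_) ⟨Fin.castLE hm, Finset.mem_univ _, ?_⟩
  · rw [pow_zero, one_mul]
    exact mul_nonneg (Finset.prod_nonneg fun x _ => (weight_pos hβ _ t).le)
      (solitonCoeff_nonneg fun x => hζ _)
  · rw [pow_zero, one_mul]
    exact mul_pos (Finset.prod_pos fun x _ => weight_pos hβ _ t)
      (solitonCoeff_pos (fun x => hζ _) (hζ_mono.injective.comp (Fin.castLE_injective hm)))

/-- A word longer than the number of nodes repeats a node. -/
lemma tauMoment_eq_zero {m : ℕ} (hm : n < m) (r : ℕ) (t : ℝ) : tauMoment ζ β r m t = 0 := by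
  rw [tauMoment, Finset.sum_eq_zero, zero_div]
  intro g _
  obtain ⟨i, j, hij, h⟩ := Fintype.exists_ne_map_eq_of_card_lt g (by simpa using hm)
  rw [solitonCoeff_eq_zero hij (by rw [h]), mul_zero, mul_zero]

end

end BToda

theorem mainTheorem4 (n : ℕ) (ζ β : Fin n → ℝ) (hζ_mono : StrictMono ζ)
    (hζ_pos : ∀ j, 0 < ζ j) (hβ_pos : ∀ j, 0 < β j) :
    (∀ (i j : ℕ) (t : ℝ),
      IntegrableOn (BToda.entryIntegrand ζ β i j) (BToda.wedge t) volume) ∧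
    (∀ k : ℤ, 1 ≤ k → k ≤ n → ∀ t, 0 < BToda.tau ζ β k t) ∧
    (∀ k : ℤ, 0 ≤ k → k ≤ n →
      Differentiable ℝ (fun t => Real.log (BToda.tau ζ β k t))) ∧
    ∀ p q : ℤ → ℝ → ℝ,
      (∀ k : ℤ, 0 ≤ k → k ≤ n → ∀ t, p k t =
        BToda.tau ζ β (k + 1) t * BToda.tau ζ β (k - 1) t / BToda.tau ζ β k t ^ 2) →
      (∀ k : ℤ, 0 ≤ k → k ≤ n → ∀ t, q k t =
        deriv (fun u => Real.log (BToda.tau ζ β k u)) t) →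
      BToda.IsSolution n p q := by
  have hτ : ∀ m : ℕ, BToda.tau ζ β (m : ℤ) = BToda.tauMoment ζ β 0 m :=
    BToda.tau_eq_tauMoment hζ_mono hζ_pos
  have hpos : ∀ m : ℕ, m ≤ n → ∀ t, 0 < BToda.tauMoment ζ β 0 m t :=
    fun m hm t => BToda.tauMoment_zero_pos hζ_mono hζ_pos hβ_pos hm t
  have hlog : ∀ m : ℕ, m ≤ n → ∀ t, HasDerivAt (fun u => Real.log (BToda.tau ζ β m u))
      (BToda.tauMoment ζ β 1 m t / BToda.tauMoment ζ β 0 m t) t := by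
    intro m hm t
    rw [hτ]
    exact (BToda.hasDerivAt_tauMoment 0 m t).log (hpos m hm t).ne'
  refine ⟨fun i j t => BToda.integrableOn_entryIntegrand hζ_pos i j t, ?_, ?_, ?_⟩
  · intro k hk hkn t
    lift k to ℕ using by omega
    rw [hτ]
    exact hpos k (by omega) t
  · intro k hk hkn
    lift k to ℕ using hk
    exact fun t => (hlog k (by omega) t).differentiableAt
  · intro p q hp hq
    have hqm : ∀ m : ℕ, m ≤ n → ∀ t,
        q m t = BToda.tauMoment ζ β 1 m t / BToda.tauMoment ζ β 0 m t := by
      intro m hm t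
      rw [hq m (by omega) (by omega), (hlog m hm t).deriv]
    have hpm : ∀ l : ℕ, l + 1 ≤ n → ∀ t, p ((l + 1 : ℕ) : ℤ) t =
        BToda.tauMoment ζ β 0 (l + 2) t * BToda.tauMoment ζ β 0 l t /
          BToda.tauMoment ζ β 0 (l + 1) t ^ 2 := by
      intro l hl t
      rw [hp _ (by omega) (by omega),
        show ((l + 1 : ℕ) : ℤ) + 1 = ((l + 2 : ℕ) : ℤ) by push_cast; ring,
        show ((l + 1 : ℕ) : ℤ) - 1 = (l : ℤ) by push_cast; ring, hτ, hτ, hτ]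
    have hplast : ∀ t, p n t = 0 := by
      intro t
      rw [hp n (by omega) le_rfl, show (n : ℤ) + 1 = ((n + 1 : ℕ) : ℤ) by push_cast; ring,
        hτ (n + 1), BToda.tauMoment_eq_zero (Nat.lt_succ_self n), zero_mul, zero_div]
    have hder := fun r m t => BToda.hasDerivAt_tauMoment (ζ := ζ) (β := β) r m t
    refine ⟨?_, hplast, ?_, fun t => by rw [hplast, zero_mul], ?_, ?_⟩
    · intro t
      have h : BToda.tau ζ β (0 - 1) t = 0 := rfl
      rw [hp 0 le_rfl (by omega), h, mul_zero, zero_div]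
    · intro t
      have h : BToda.tauMoment ζ β 1 0 t = 0 := by simp [BToda.tauMoment]
      exact (hqm 0 (Nat.zero_le n) t).trans (by rw [h, zero_div])
    · intro k hk hkn t
      obtain ⟨l, rfl⟩ : ∃ l : ℕ, k = ((l + 1 : ℕ) : ℤ) := ⟨(k - 1).toNat, by omega⟩
      by_cases hl : l + 1 = n
      · have h0 : p ((l + 1 : ℕ) : ℤ) = fun _ => 0 := by
          rw [hl]
          exact funext hplast
        rw [h0]
        simpa using hasDerivAt_const t (0 : ℝ)
      · have hln : l + 2 ≤ n := by omega
        rw [show ((l + 1 : ℕ) : ℤ) + 1 = ((l + 2 : ℕ) : ℤ) by push_cast; ring,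
          show ((l + 1 : ℕ) : ℤ) - 1 = (l : ℤ) by push_cast; ring, hqm _ hln,
          hqm (l + 1) (by omega), hqm l (by omega), funext (hpm l (by omega))]
        have h0 := (hpos l (by omega) t).ne'
        have h1 := (hpos (l + 1) (by omega) t).ne'
        have h2 := (hpos (l + 2) hln t).ne'
        refine (((hder 0 (l + 2) t).mul (hder 0 l t)).div ((hder 0 (l + 1) t).pow 2)
          (pow_ne_zero 2 h1)).congr_deriv ?_
        simp only [Pi.mul_apply, Pi.pow_apply]
        push_cast
        field_simp
        ring
    · intro k hk hkn t
      obtain ⟨l, rfl⟩ : ∃ l : ℕ, k = ((l + 1 : ℕ) : ℤ) := ⟨(k - 1).toNat, by omega⟩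
      have hl : l + 1 ≤ n := by omega
      have h0 := (hpos l (by omega) t).ne'
      have h1 := (hpos (l + 1) hl t).ne'
      have hbil := BToda.tauMoment_bilinear (β := β) hζ_pos l t
      have hq' : HasDerivAt (q ((l + 1 : ℕ) : ℤ)) ((BToda.tauMoment ζ β 2 (l + 1) t *
          BToda.tauMoment ζ β 0 (l + 1) t - BToda.tauMoment ζ β 1 (l + 1) t ^ 2) /
          BToda.tauMoment ζ β 0 (l + 1) t ^ 2) t := by
        rw [funext (hqm (l + 1) hl)]
        refine ((hder 1 (l + 1) t).div (hder 0 (l + 1) t) h1).congr_deriv ?_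
        ring
      rw [hbil] at hq'
      convert hq' using 1
      -- for `k = n` both sides vanish, whatever the value of `q (n + 1)`
      by_cases hln : l + 1 = n
      · have h2 : p ((l + 1 : ℕ) : ℤ) t = 0 := by
          rw [hln]
          exact hplast t
        rw [h2, BToda.tauMoment_eq_zero (show n < l + 2 by omega),
          BToda.tauMoment_eq_zero (show n < l + 2 by omega)]
        simp
      · have hln2 : l + 2 ≤ n := by omega
        have h2 := (hpos (l + 2) hln2 t).ne'
        rw [show ((l + 1 : ℕ) : ℤ) + 1 = ((l + 2 : ℕ) : ℤ) by push_cast; ring,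
          show ((l + 1 : ℕ) : ℤ) - 1 = (l : ℤ) by push_cast; ring, hqm _ hln2,
          hqm l (by omega), hpm l hl]
        field_simp
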